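/- Conventions. Squares are pairs (row, column), numbered from $0$, with rows going from top to bottom. For a skew shape $\chi=\lambda/\mu$ (partitions $\mu\subseteq\lambda$), $\mathrm{Tab}(\chi)$ is the set of semistandard tableaux of shape $\chi$ with entries in $\mathbb N$ (weakly increasing along rows, strictly increasing down columns), and $\mathrm{Tab}(\chi;n)$ is the subset of those with entries in $\{0,\dots,n-1\}$; for a partition $\nu$, $\mathrm{Tab}(\nu;n)=\mathrm{Tab}(\nu/0;n)$. The weight $\mathrm{wt}\,T$ records for each $i$ the number of entries $i$ of $T$. A valid reading order for $\chi$ is a total order on the squares of $\chi$ in which $(i,j)$ precedes or equals $(i',j')$ whenever $i\le i'$ and $j\ge j'$; the corresponding reading word of $T$ lists its entries in that order. A word is dominant for $i$ if each of its prefixes has at least as many letters $i$ as letters $i+1$, and anti-dominant for $i$ if each of its suffixes has at least as many letters $i+1$ as letters $i$. $\mathrm{LR}(\chi,\nu)$ is the set of Littlewood--Richardson tableaux of shape $\chi$ and weight $\nu$: those $L\in\mathrm{Tab}(\chi)$ of weight $\nu$ whose word, read by rows from top to bottom and from right to left within each row, is dominant for every $i$. Raising operations. For words, $e_i(u\,(i+1)\,v)=u\,i\,v$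 when $u$ is anti-dominant and $v$ is dominant for $i$. For tableaux of shape $\chi$ and a valid reading order, $U=e_i(T)$ means that the reading word of $U$ is obtained by applying $e_i$ to the reading word of $T$. The raising operations are the $e_i$ for all $i\ge0$. Inward jeu de taquin slides. Choose a corner $s$ of $\mu$ and make it the empty square. Repeatedly move into the empty square the smaller of the entries directly to its right and directly below it (the one below in case of equality; the only one if just one is present), until neither exists. If the empty square then is $t$, the result is a tableau of shape $(\lambda\setminus\{t\})/(\mu\setminus\{s\})$. A normal form of $T$ for a rewrite system is an object obtainable from $T$ by finitely many (possibly zero) steps, to which no step applies. Statement. Let $\chi$ be a skew shape and $n\in\mathbb N$. Every $T\in\mathrm{Tab}(\chi;n)$ has a unique normal form $\mathrm{Rob}_0(T)$ for the raising operations, which is the same for every valid reading order, and a unique normal form $\mathrm{Rob}_1(T)$ for inward jeu de taquin slides. There is a partition $\nu$ such that $\mathrm{Rob}_0(T)\in\mathrm{LR}(\chi,\nu)$ and $\mathrm{Rob}_1(T)\in\mathrm{Tab}(\nu;n)$, and $\mathrm{wt}\,\mathrm{Rob}_1(T)=\mathrm{wt}\,T$. The map $T\mapsto(\mathrm{Rob}_0(T),\mathrm{Rob}_1(T))$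 is a bijection $$\mathrm{Tab}(\chi;n)\longrightarrow\bigsqcup_{\nu}\mathrm{LR}(\chi,\nu)\times\mathrm{Tab}(\nu;n),$$ where $\nu$ ranges over all partitions; that is, it is a Robinson bijection. -/

import Mathlib

/-! ### Skew shapes and skew semistandard tableaux

Squares are pairs (row, column), both counted from 0, rows from top to bottom; partitions are
Young diagrams. -/

/-- A skew shape `outer / inner`. -/
structure SkewShape where
  outer : YoungDiagram
  inner : YoungDiagram
  inner_le : inner ≤ outer

namespace SkewShape

/-- The set of squares of a skew shape. -/
def cells (χ : SkewShape) : Finset (ℕ × ℕ) := χ.outer.cells \ χ.inner.cells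

/-- The partition `ν`, regarded as the skew shape `ν / 0`. -/
def ofPartition (ν : YoungDiagram) : SkewShape := ⟨ν, ⊥, bot_le⟩

end SkewShape

/-- Skew semistandard tableaux of shape `χ` with entries in `ℕ`: weakly increasing along rows,
strictly increasing down columns. The value of `entry` outside the shape is `0` by convention. -/
@[ext]
structure SkewTableau (χ : SkewShape) where
  entry : ℕ × ℕ → ℕ
  row_weak : ∀ i j j' : ℕ, j < j' → (i, j) ∈ χ.cells → (i, j') ∈ χ.cells →
    entry (i, j) ≤ entry (i, j')
  col_strict : ∀ i i' j : ℕ, i < i' → (i, j) ∈ χ.cells → (i', j) ∈ χ.cells →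
    entry (i, j) < entry (i', j)
  zeros : ∀ c : ℕ × ℕ, c ∉ χ.cells → entry c = 0

/-- The weight of a tableau: component `i` counts the entries equal to `i`. -/
def SkewTableau.weight {χ : SkewShape} (T : SkewTableau χ) (i : ℕ) : ℕ :=
  (χ.cells.filter (fun c => T.entry c = i)).card

/-- `Tab χ n`: the skew semistandard tableaux of shape `χ` with entries in `{0, …, n - 1}`. -/
def Tab (χ : SkewShape) (n : ℕ) : Type :=
  {T : SkewTableau χ // ∀ c ∈ χ.cells, T.entry c < n}

/-! ### Valid reading orders -/

/-- A valid reading order for `χ`: a total order on the squares of `χ` in which `(i, j)` comes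
before `(i', j')` whenever `i ≤ i'` and `j ≥ j'`. It is given by the list of all squares in
increasing order, so validity says that a square `t` that must precede `s` is not listed after
`s`. -/
structure ReadingOrder (χ : SkewShape) where
  squares : List (ℕ × ℕ)
  nodup : squares.Nodup
  mem_squares : ∀ c : ℕ × ℕ, c ∈ squares ↔ c ∈ χ.cells
  valid : squares.Pairwise (fun s t => ¬ (t.1 ≤ s.1 ∧ s.2 ≤ t.2))

/-- The word formed by the entries of `T`, listed in the reading order `r`. -/
def SkewTableau.word {χ : SkewShape} (T : SkewTableau χ) (r : ReadingOrder χ) : List ℕ :=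
  r.squares.map T.entry

/-- The squares of row `i` of `χ`, from right to left. -/
def SkewShape.revRow (χ : SkewShape) (i : ℕ) : List (ℕ × ℕ) :=
  (((List.range (χ.outer.rowLen i)).filter
    (fun j => χ.inner.rowLen i ≤ j)).reverse).map (fun j => (i, j))

theorem SkewShape.mem_revRow (χ : SkewShape) (i : ℕ) (c : ℕ × ℕ) :
    c ∈ χ.revRow i ↔ c.1 = i ∧ c ∈ χ.cells := by
  obtain ⟨a, b⟩ := c
  simp only [SkewShape.revRow, SkewShape.cells, List.mem_map, List.mem_reverse, List.mem_filter,
    List.mem_range, decide_eq_true_eq, Prod.mk.injEq, Finset.mem_sdiff, YoungDiagram.mem_cells,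
    YoungDiagram.mem_iff_lt_rowLen]
  constructor
  · rintro ⟨j, ⟨h1, h2⟩, rfl, rfl⟩
    exact ⟨rfl, h1, by omega⟩
  · rintro ⟨rfl, h1, h2⟩
    exact ⟨b, ⟨h1, by omega⟩, rfl, rfl⟩

theorem SkewShape.pairwise_revRow (χ : SkewShape) (i : ℕ) :
    (χ.revRow i).Pairwise (fun s t => t.2 < s.2) := by
  unfold SkewShape.revRow
  rw [List.pairwise_map, List.pairwise_reverse]
  exact List.Pairwise.filter _ List.pairwise_lt_range

/-- The Semitic reading order: rows from top to bottom, each row from right to left. -/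
def SkewShape.semitic (χ : SkewShape) : ReadingOrder χ where
  squares := (List.range (χ.outer.colLen 0)).flatMap χ.revRow
  nodup := by
    rw [List.nodup_flatMap]
    refine ⟨fun i _ => (χ.pairwise_revRow i).imp (fun h e => by subst e; omega), ?_⟩
    refine List.pairwise_lt_range.imp ?_
    intro a b hab c ha hb
    have h1 := ((χ.mem_revRow a c).1 ha).1
    have h2 := ((χ.mem_revRow b c).1 hb).1
    omega
  mem_squares c := by
    simp only [List.mem_flatMap, List.mem_range, SkewShape.mem_revRow]
    constructor
    · rintro ⟨i, _, _, h⟩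
      exact h
    · intro h
      refine ⟨c.1, ?_, rfl, h⟩
      have h1 : c ∈ χ.outer := (Finset.mem_sdiff.1 h).1
      rw [← YoungDiagram.mem_iff_lt_colLen]
      exact χ.outer.up_left_mem le_rfl (Nat.zero_le _) h1
  valid := by
    rw [List.pairwise_flatMap]
    refine ⟨fun i _ => (χ.pairwise_revRow i).imp (fun h e => by omega), ?_⟩
    refine List.pairwise_lt_range.imp ?_
    intro a b hab s hs t ht e
    have h1 := ((χ.mem_revRow a s).1 hs).1
    have h2 := ((χ.mem_revRow b t).1 ht).1
    omega

/-! ### Coplactic (raising) operations -/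

/-- `w` is dominant for `i`: every prefix has at least as many letters `i` as `i + 1`. -/
def WordDominantFor (i : ℕ) (w : List ℕ) : Prop :=
  ∀ u : List ℕ, u <+: w → u.count (i + 1) ≤ u.count i

/-- `w` is anti-dominant for `i`: every suffix has at least as many letters `i + 1` as `i`. -/
def WordAntiDominantFor (i : ℕ) (w : List ℕ) : Prop :=
  ∀ v : List ℕ, v <:+ w → v.count i ≤ v.count (i + 1)

/-- `w' = e_i(w)`: one letter `i + 1` of `w` is changed into `i`, the part of `w` to the left of
that letter being anti-dominant for `i` and the part to its right dominant for `i`. -/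
def WordRaise (i : ℕ) (w w' : List ℕ) : Prop :=
  ∃ u v : List ℕ, WordAntiDominantFor i u ∧ WordDominantFor i v ∧
    w = u ++ (i + 1) :: v ∧ w' = u ++ i :: v

/-- One step of the rewrite system of raising operations, determined using the reading order `r`:
`U = e_i(T)` for some `i`. As `U` has the shape of `T`, the equation between words says that `U` is
obtained from `T` by changing the entry of the square that is read as the changing letter. -/
def RaisingStep {χ : SkewShape} (r : ReadingOrder χ) (T U : SkewTableau χ) : Prop :=
  ∃ i : ℕ, WordRaise i (T.word r) (U.word r)

/-- `LR χ ν`: Littlewood-Richardson tableaux of shape `χ` and weight `ν`, i.e., tableaux whose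
(Semitic) reading word is a lattice permutation (every prefix contains, for each `i`, at least as
many letters `i` as `i + 1`). -/
def LR (χ : SkewShape) (ν : YoungDiagram) : Type :=
  {L : SkewTableau χ // (∀ i : ℕ, WordDominantFor i (L.word χ.semitic)) ∧
    ∀ i : ℕ, L.weight i = ν.rowLen i}

/-! ### Normal forms of rewrite systems -/

/-- `y` is a normal form of `x` for the rewrite system `R`: it can be reached from `x`, and no
rewrite step can be applied to it. -/
def IsNormalFormOf {α : Type} (R : α → α → Prop) (x y : α) : Prop :=
  Relation.ReflTransGen R x y ∧ ∀ z : α, ¬ R y z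

/-! ### Jeu de taquin -/

/-- A single move inside an inward slide on a tableau with outer shape `lam`. The state is the
position of the empty square together with the filling. The smaller one of the entries to the right
of and below the empty square moves into it (in case of equality, the one from below). -/
inductive SlideMove (lam : YoungDiagram) :
    (ℕ × ℕ) × (ℕ × ℕ → ℕ) → (ℕ × ℕ) × (ℕ × ℕ → ℕ) → Prop
  | up (i j : ℕ) (f : ℕ × ℕ → ℕ) (hmem : (i + 1, j) ∈ lam)
      (hle : (i, j + 1) ∈ lam → f (i + 1, j) ≤ f (i, j + 1)) :
      SlideMove lam ((i, j), f)
        ((i + 1, j), Function.update (Function.update f (i, j) (f (i + 1, j))) (i + 1, j) 0)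
  | left (i j : ℕ) (f : ℕ × ℕ → ℕ) (hmem : (i, j + 1) ∈ lam)
      (hlt : (i + 1, j) ∈ lam → f (i, j + 1) < f (i + 1, j)) :
      SlideMove lam ((i, j), f)
        ((i, j + 1), Function.update (Function.update f (i, j) (f (i, j + 1))) (i, j + 1) 0)

/-- `T'` is obtained from `T` by one inward jeu de taquin slide: a corner `s` of the inner shape
becomes the empty square, moves are made as long as possible, and the square `t` where the empty
square ends up is removed from the outer shape. (As both `inner` shapes are Young diagrams, `s` is a
corner of the first one.) -/
def InwardSlide (T T' : Σ χ : SkewShape, SkewTableau χ) : Prop :=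
  ∃ s t : ℕ × ℕ, s ∈ T.1.inner ∧
    T'.1.inner.cells = T.1.inner.cells.erase s ∧
    T'.1.outer.cells = T.1.outer.cells.erase t ∧
    IsNormalFormOf (SlideMove T.1.outer) (s, T.2.entry) (t, T'.2.entry)

/-! Read tableaux along the rows, from top to bottom and from right to left. An inward slide changes
the word of a tableau only by Knuth relations, and a Knuth relation is realized by an involution of
the set of all words that commutes with every raising operation. Hence the words of a tableau `T`
and of a rectification `P` of `T` are related by a permutation `φ` of the words that commutes with
the raising operations, and so carries the raising sequences of `T` to those of `P`.

A straight shape `ν` carries only one dominant tableau, and its weight is `ν`. As raising operations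
are injective, this leaves only one rectification of `T`. Pulling back along `φ` shows that `T` has
only one normal form `L` for the raising operations, that the weight of `L` is `ν`, and that `T` can
be recovered from `L` and `P`: rectify `L` to the dominant tableau of shape `ν`, and bring the
raising sequence from `P` to that tableau back to one that ends in `L`.

Raising does not depend on the reading order because an entry `i` just above an entry `i + 1` is
matched with it in every valid reading, while the other entries `i` and `i + 1` occur in the same
order in all valid readings. -/

/-- One step of bracket matching between letters `p` and `m`: when `d` letters `p` are pending, the
letter `a` becomes pending too if it is `p`, and settles a pending one, if any, if it is `m`. -/
def matchStep (p m a d : ℕ) : ℕ := if a = p then d + 1 else if a = m then d - 1 else d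

/-- The number of pending letters `p` after matching them, from right to left, with letters `m`,
when `d` letters `p` are pending at the start. For `p = i + 1` and `m = i` it vanishes on the words
that are dominant for `i`; the words that are anti-dominant for `i` are handled by reversal. -/
def pending (p m d : ℕ) (w : List ℕ) : ℕ := w.foldr (matchStep p m) d

section Words

variable {i d d' : ℕ} {w w' w₁ w₂ : List ℕ}

@[simp] theorem pending_nil (p m d : ℕ) : pending p m d [] = d := rfl

@[simp] theorem pending_cons (p m d a : ℕ) (w : List ℕ) :
    pending p m d (a :: w) = matchStep p m a (pending p m d w) := rfl

theorem pending_append (p m d : ℕ) (u v : List ℕ) :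
    pending p m d (u ++ v) = pending p m (pending p m d v) u :=
  List.foldr_append

theorem pending_le_iff {p m : ℕ} (hpm : p ≠ m) {k : ℕ} :
    pending p m 0 w ≤ k ↔ ∀ u, u <+: w → u.count p ≤ u.count m + k := by
  induction w generalizing k with
  | nil => simp
  | cons a w ih =>
    have prefixes_cons : (∀ u, u <+: a :: w → u.count p ≤ u.count m + k) ↔
        ∀ u, u <+: w → (a :: u).count p ≤ (a :: u).count m + k := by
      simp only [List.prefix_cons_iff]
      grind
    rw [prefixes_cons, pending_cons]
    rcases eq_or_ne a p with rfl | hap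
    · cases k with
      | zero => simpa [matchStep] using ⟨[], List.nil_prefix, by simp [hpm]⟩
      | succ k => simp [matchStep, hpm, ih, ← add_assoc]
    · rcases eq_or_ne a m with rfl | ham
      · simp [matchStep, hap, ih, add_right_comm, add_assoc]
      · simp [matchStep, hap, ham, ih]

theorem wordDominantFor_iff_pending : WordDominantFor i w ↔ pending (i + 1) i 0 w = 0 := by
  simpa [WordDominantFor] using (pending_le_iff (w := w) (k := 0) i.succ_ne_self).symm

theorem wordAntiDominantFor_iff_pending :
    WordAntiDominantFor i w ↔ pending i (i + 1) 0 w.reverse = 0 := by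
  have h := (pending_le_iff (w := w.reverse) (k := 0) i.succ_ne_self.symm).symm
  simp only [Nat.le_zero, Nat.add_zero, ← List.reverse_suffix, List.reverse_reverse] at h
  rw [← h, WordAntiDominantFor, List.reverse_surjective.forall]
  simp only [List.count_reverse]

/-- `w' = e_i(w)` relative to a prefix with `d` letters `i` pending, that is, not followed by a
matching `i + 1`. In this form, the raising operations can be studied by recursion on words. -/
def RaiseFrom (i d : ℕ) : List ℕ → List ℕ → Prop
  | a :: w, a' :: w' =>
    (d = 0 ∧ a = i + 1 ∧ a' = i ∧ w = w' ∧ pending (i + 1) i 0 w = 0) ∨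
      (a = a' ∧ RaiseFrom i (matchStep i (i + 1) a d) w w')
  | _, _ => False

theorem raiseFrom_iff_exists : RaiseFrom i d w w' ↔ ∃ u v,
    pending i (i + 1) d u.reverse = 0 ∧ pending (i + 1) i 0 v = 0 ∧
      w = u ++ (i + 1) :: v ∧ w' = u ++ i :: v := by
  constructor
  · induction w generalizing d w' with
    | nil => simp [RaiseFrom]
    | cons a w ih =>
      rcases w' with - | ⟨a', w'⟩
      · simp [RaiseFrom]
      rintro (⟨rfl, rfl, rfl, rfl, hw⟩ | ⟨rfl, h⟩)
      · exact ⟨[], w, rfl, hw, rfl, rfl⟩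
      · obtain ⟨u, v, hu, hv, rfl, rfl⟩ := ih h
        exact ⟨a :: u, v, by simpa [pending_append] using hu, hv, rfl, rfl⟩
  · rintro ⟨u, v, hu, hv, rfl, rfl⟩
    induction u generalizing d with
    | nil => exact .inl ⟨hu, rfl, rfl, rfl, hv⟩
    | cons a u ih => exact .inr ⟨rfl, ih (by simpa [pending_append] using hu)⟩

theorem wordRaise_iff_raiseFrom : WordRaise i w w' ↔ RaiseFrom i 0 w w' := by
  simp only [raiseFrom_iff_exists, WordRaise, wordDominantFor_iff_pending,
    wordAntiDominantFor_iff_pending]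

theorem RaiseFrom.pending_eq (h : RaiseFrom i d w w') :
    d < pending (i + 1) i 0 w ∧ pending (i + 1) i 0 w = pending (i + 1) i 0 w' + 1 := by
  induction w generalizing d w' with
  | nil => simp [RaiseFrom] at h
  | cons a w ih =>
    rcases w' with - | ⟨a', w'⟩
    · simp [RaiseFrom] at h
    rcases h with ⟨rfl, rfl, rfl, rfl, hw⟩ | ⟨rfl, h⟩
    · simp [matchStep, hw]
    · have := ih h
      simp only [pending_cons, matchStep] at this ⊢
      grind

theorem RaiseFrom.left_unique (h₁ : RaiseFrom i d w₁ w) (h₂ : RaiseFrom i d w₂ w) :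
    w₁ = w₂ := by
  induction w generalizing d w₁ w₂ with
  | nil => rcases w₁ with - | ⟨a₁, w₁⟩ <;> simp [RaiseFrom] at h₁
  | cons a w ih =>
    rcases w₁ with - | ⟨a₁, w₁⟩
    · simp [RaiseFrom] at h₁
    rcases w₂ with - | ⟨a₂, w₂⟩
    · simp [RaiseFrom] at h₂
    -- A raise whose result is `w` leaves at least as many pending letters `i + 1` in `w` as there
    -- are pending letters `i` before `w`; so after a letter `i` its result is not dominant.
    have not_head {v : List ℕ} (h : RaiseFrom i (matchStep i (i + 1) i d) v w) :
        pending (i + 1) i 0 w ≠ 0 := by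
      have := h.pending_eq
      simp only [matchStep] at this
      grind
    rcases h₁ with ⟨rfl, rfl, rfl, rfl, hw⟩ | ⟨rfl, h₁⟩ <;>
      rcases h₂ with ⟨-, rfl, ha, rfl, hw'⟩ | ⟨rfl, h₂⟩
    · rfl
    · exact absurd hw (not_head h₂)
    · exact absurd hw' (not_head (ha ▸ h₁))
    · rw [ih h₁ h₂]

theorem exists_raiseFrom (h : d < pending (i + 1) i 0 w) : ∃ w', RaiseFrom i d w w' := by
  induction w generalizing d with
  | nil => simp at h
  | cons a w ih =>
    by_cases head : d = 0 ∧ a = i + 1 ∧ pending (i + 1) i 0 w = 0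
    · exact ⟨i :: w, .inl ⟨head.1, head.2.1, rfl, rfl, head.2.2⟩⟩
    · have : matchStep i (i + 1) a d < pending (i + 1) i 0 w := by
        simp only [pending_cons, matchStep] at h ⊢
        grind
      obtain ⟨w', hw'⟩ := ih this
      exact ⟨a :: w', .inr ⟨rfl, hw'⟩⟩

theorem WordRaise.left_unique (h₁ : WordRaise i w₁ w) (h₂ : WordRaise i w₂ w) : w₁ = w₂ :=
  (wordRaise_iff_raiseFrom.1 h₁).left_unique (wordRaise_iff_raiseFrom.1 h₂)

theorem wordDominantFor_iff_forall_not_wordRaise :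
    WordDominantFor i w ↔ ∀ w', ¬ WordRaise i w w' := by
  simp only [wordDominantFor_iff_pending, wordRaise_iff_raiseFrom]
  refine ⟨fun hw w' h => by have := h.pending_eq; omega, fun h => ?_⟩
  by_contra hw
  obtain ⟨w', hw'⟩ := exists_raiseFrom (d := 0) (Nat.pos_of_ne_zero hw)
  exact h w' hw'

theorem WordRaise.sum_eq (h : WordRaise i w w') : w.sum = w'.sum + 1 := by
  obtain ⟨u, v, -, -, rfl, rfl⟩ := h
  simp only [List.sum_append, List.sum_cons]
  omega

end Words

/-- The elementary Knuth relations, for words that are read along rows from right to left: the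
exchange of two adjacent letters `x < z` next to a letter `y` that lies between them. -/
inductive KnuthStep : List ℕ → List ℕ → Prop
  | witness_right (u v : List ℕ) {x y z : ℕ} (hxy : x < y) (hyz : y ≤ z) :
    KnuthStep (u ++ [x, z, y] ++ v) (u ++ [z, x, y] ++ v)
  | witness_left (u v : List ℕ) {x y z : ℕ} (hxy : x ≤ y) (hyz : y < z) :
    KnuthStep (u ++ [y, z, x] ++ v) (u ++ [y, x, z] ++ v)

/-- The Knuth relation, if there is one, applied to the first three letters of a word, in either
direction; other words are left unchanged. -/
def knuthSwap : List ℕ → List ℕ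
  | a :: b :: c :: v =>
    if a < c ∧ c ≤ b ∨ b < c ∧ c ≤ a then b :: a :: c :: v
    else if c ≤ a ∧ a < b ∨ b ≤ a ∧ a < c then a :: c :: b :: v
    else a :: b :: c :: v
  | w => w

/-- `knuthSwap` applied to the letters at positions `k`, `k + 1`, `k + 2`. -/
def knuthMove : ℕ → List ℕ → List ℕ
  | 0, w => knuthSwap w
  | _ + 1, [] => []
  | k + 1, a :: w => a :: knuthMove k w

section KnuthMove

variable {i d : ℕ} {w w' : List ℕ}

theorem knuthSwap_involutive : Function.Involutive knuthSwap := by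
  rintro (- | ⟨a, - | ⟨b, - | ⟨c, v⟩⟩⟩) <;> try rfl
  simp only [knuthSwap]
  grind

theorem knuthMove_involutive (k : ℕ) : Function.Involutive (knuthMove k) := by
  intro w
  induction k generalizing w with
  | zero => exact knuthSwap_involutive w
  | succ k ih => cases w <;> simp [knuthMove, ih _]

theorem knuthMove_perm (k : ℕ) (w : List ℕ) : (knuthMove k w).Perm w := by
  induction k generalizing w with
  | zero =>
    rcases w with - | ⟨a, - | ⟨b, - | ⟨c, v⟩⟩⟩ <;> simp only [knuthMove, knuthSwap] <;> try rfl
    split_ifs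
    · exact .swap a b _
    · exact (List.Perm.swap b c v).cons a
    · rfl
  | succ k ih => cases w <;> simp [knuthMove, ih _]

theorem pending_knuthMove (k : ℕ) (w : List ℕ) :
    pending (i + 1) i d (knuthMove k w) = pending (i + 1) i d w := by
  induction k generalizing w with
  | zero =>
    rcases w with - | ⟨a, - | ⟨b, - | ⟨c, v⟩⟩⟩ <;> simp only [knuthMove, knuthSwap]
    split_ifs <;> simp only [pending_cons, matchStep] <;> grind
  | succ k ih => cases w <;> simp [knuthMove, ih _]

theorem RaiseFrom.knuthSwap (h : RaiseFrom i d w w') :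
    RaiseFrom i d (knuthSwap w) (knuthSwap w') := by
  rcases w with - | ⟨a, - | ⟨b, - | ⟨c, v⟩⟩⟩ <;>
    rcases w' with - | ⟨a', - | ⟨b', - | ⟨c', v'⟩⟩⟩ <;>
    try first | exact h | simp [RaiseFrom] at h; done
  simp only [_root_.knuthSwap]
  rcases h with ⟨hd, rfl, rfl, he, hv⟩ | ⟨rfl, ⟨hd, rfl, rfl, he, hv⟩ |
    ⟨rfl, ⟨hd, rfl, rfl, rfl, hv⟩ | ⟨rfl, h⟩⟩⟩
  · obtain ⟨rfl, rfl, rfl⟩ : b = b' ∧ c = c' ∧ v = v' := by simpa using he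
    simp only [pending_cons, matchStep] at hv
    split_ifs <;> simp only [RaiseFrom, matchStep, pending_cons] <;> grind
  · obtain ⟨rfl, rfl⟩ : c = c' ∧ v = v' := by simpa using he
    simp only [pending_cons, matchStep] at hv hd
    split_ifs <;> simp only [RaiseFrom, matchStep, pending_cons] <;> grind
  · simp only [matchStep] at hd
    split_ifs <;> simp only [RaiseFrom, matchStep, pending_cons] <;> grind
  · split_ifs <;> refine .inr ⟨rfl, .inr ⟨rfl, .inr ⟨rfl, ?_⟩⟩⟩ <;> convert h using 1 <;>
      simp only [matchStep] <;> grind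

theorem RaiseFrom.knuthMove (k : ℕ) (h : RaiseFrom i d w w') :
    RaiseFrom i d (knuthMove k w) (knuthMove k w') := by
  induction k generalizing d w w' with
  | zero => exact h.knuthSwap
  | succ k ih =>
    rcases w with - | ⟨a, w⟩ <;> rcases w' with - | ⟨a', w'⟩ <;> try exact h
    rcases h with ⟨rfl, rfl, rfl, rfl, hw⟩ | ⟨rfl, h⟩
    · exact .inl ⟨rfl, rfl, rfl, rfl, (pending_knuthMove k w).trans hw⟩
    · exact .inr ⟨rfl, ih h⟩

theorem KnuthStep.exists_knuthMove_eq (h : KnuthStep w w') : ∃ k, knuthMove k w = w' := by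
  have knuthMove_append {t t' : List ℕ} (ht : knuthSwap t = t') (u : List ℕ) :
      knuthMove u.length (u ++ t) = u ++ t' := by
    induction u with
    | nil => exact ht
    | cons a u ih => simp [_root_.knuthMove, ih]
  obtain ⟨u, v, hxy, hyz⟩ | ⟨u, v, hxy, hyz⟩ := h <;>
    exact ⟨u.length, by
      rw [List.append_assoc, List.append_assoc]
      exact knuthMove_append (by simp only [List.cons_append, List.nil_append, knuthSwap]; grind) u⟩

end KnuthMove

/-- The coplactic automorphisms: the permutations of the set of words that commute with the raising
operations and rearrange the letters of each word. Knuth equivalent words are related by such a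
permutation, which may be applied to an entire orbit of raising operations at once. -/
def coplacticAut : Subgroup (Equiv.Perm (List ℕ)) where
  carrier := {φ | (∀ i w w', WordRaise i (φ w) (φ w') ↔ WordRaise i w w') ∧
    ∀ w, (φ w).Perm w}
  one_mem' := ⟨fun _ _ _ => .rfl, fun _ => .rfl⟩
  mul_mem' hφ hψ := ⟨fun _ _ _ => (hφ.1 _ _ _).trans (hψ.1 _ _ _),
    fun _ => (hφ.2 _).trans (hψ.2 _)⟩
  inv_mem' {φ} hφ := ⟨fun i w w' => by simpa using (hφ.1 i (φ⁻¹ w) (φ⁻¹ w')).symm,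
    fun w => by simpa using (hφ.2 (φ⁻¹ w)).symm⟩

/-- Knuth equivalence of words. -/
def KnuthEquiv : List ℕ → List ℕ → Prop := Relation.EqvGen KnuthStep

namespace KnuthEquiv

variable {w w' w'' : List ℕ}

protected theorem refl (w : List ℕ) : KnuthEquiv w w := Relation.EqvGen.refl w

protected theorem symm (h : KnuthEquiv w w') : KnuthEquiv w' w := Relation.EqvGen.symm _ _ h

protected theorem trans (h : KnuthEquiv w w') (h' : KnuthEquiv w' w'') : KnuthEquiv w w'' :=
  Relation.EqvGen.trans _ _ _ h h'

instance : Trans KnuthEquiv KnuthEquiv KnuthEquiv := ⟨KnuthEquiv.trans⟩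

theorem append_append (h : KnuthEquiv w w') (u v : List ℕ) :
    KnuthEquiv (u ++ w ++ v) (u ++ w' ++ v) := by
  induction h with
  | rel w w' h =>
    refine .rel _ _ ?_
    obtain ⟨u', v', hxy, hyz⟩ | ⟨u', v', hxy, hyz⟩ := h
    · simpa using KnuthStep.witness_right (u ++ u') (v' ++ v) hxy hyz
    · simpa using KnuthStep.witness_left (u ++ u') (v' ++ v) hxy hyz
  | refl w => exact .refl _
  | symm _ _ _ ih => exact ih.symm
  | trans _ _ _ _ _ ih ih' => exact ih.trans ih'

theorem append_left (u : List ℕ) (h : KnuthEquiv w w') : KnuthEquiv (u ++ w) (u ++ w') := by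
  simpa using h.append_append u []

theorem append_right (h : KnuthEquiv w w') (v : List ℕ) : KnuthEquiv (w ++ v) (w' ++ v) := by
  simpa using h.append_append [] v

theorem cons (a : ℕ) (h : KnuthEquiv w w') : KnuthEquiv (a :: w) (a :: w') :=
  h.append_left [a]

theorem exists_coplacticAut (h : KnuthEquiv w w') : ∃ φ ∈ coplacticAut, φ w = w' := by
  induction h with
  | rel w w' h =>
    obtain ⟨k, rfl⟩ := h.exists_knuthMove_eq
    refine ⟨(knuthMove_involutive k).toPerm, ⟨fun i w w' => ?_, knuthMove_perm k⟩, rfl⟩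
    simp only [wordRaise_iff_raiseFrom, Function.Involutive.coe_toPerm]
    refine ⟨fun h => ?_, .knuthMove k⟩
    simpa only [knuthMove_involutive k _] using h.knuthMove k
  | refl w => exact ⟨1, one_mem _, rfl⟩
  | symm w w' _ ih =>
    obtain ⟨φ, hφ, rfl⟩ := ih
    exact ⟨φ⁻¹, inv_mem hφ, φ.symm_apply_apply w⟩
  | trans w w' w'' _ _ ih ih' =>
    obtain ⟨φ, hφ, rfl⟩ := ih
    obtain ⟨ψ, hψ, rfl⟩ := ih'
    exact ⟨ψ * φ, mul_mem hψ hφ, rfl⟩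

end KnuthEquiv

/-- Reachability of words by raising operations. -/
def WordRaises : List ℕ → List ℕ → Prop :=
  Relation.ReflTransGen fun w w' => ∃ i, WordRaise i w w'

section Coplactic

variable {w w' : List ℕ} {φ : Equiv.Perm (List ℕ)}

theorem wordRaises_apply_iff_of_mem_coplacticAut (hφ : φ ∈ coplacticAut) :
    WordRaises (φ w) (φ w') ↔ WordRaises w w' := by
  have lift {φ : Equiv.Perm (List ℕ)} (hφ : φ ∈ coplacticAut) {w w' : List ℕ}
      (h : WordRaises w w') : WordRaises (φ w) (φ w') :=
    Relation.ReflTransGen.lift φ (fun _ _ ⟨i, h⟩ => ⟨i, (hφ.1 i _ _).2 h⟩) _ _ h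
  exact ⟨fun h => by simpa using lift (inv_mem hφ) h, lift hφ⟩

theorem wordDominantFor_apply_iff_of_mem_coplacticAut (hφ : φ ∈ coplacticAut) (i : ℕ) :
    WordDominantFor i (φ w) ↔ WordDominantFor i w := by
  rw [wordDominantFor_iff_forall_not_wordRaise, wordDominantFor_iff_forall_not_wordRaise,
    φ.surjective.forall]
  simp only [hφ.1 i]

theorem apply_eq_self_of_wordRaises (hφ : φ ∈ coplacticAut) (h : WordRaises w w')
    (hw' : φ w' = w') : φ w = w := by
  induction h using Relation.ReflTransGen.head_induction_on with
  | refl => exact hw'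
  | head h _ ih =>
    obtain ⟨i, h⟩ := h
    exact WordRaise.left_unique (ih ▸ (hφ.1 i _ _).2 h) h

end Coplactic

theorem exists_isNormalFormOf_of_measure {α : Type} {R : α → α → Prop} (m : α → ℕ)
    (hm : ∀ x y, R x y → m y < m x) (x : α) : ∃ y, IsNormalFormOf R x y := by
  induction hn : m x using Nat.strong_induction_on generalizing x with
  | _ n ih =>
    by_cases hx : ∃ y, R x y
    · obtain ⟨y, hxy⟩ := hx
      obtain ⟨z, hyz, hz⟩ := ih (m y) (hn ▸ hm x y hxy) y rfl
      exact ⟨z, .head hxy hyz, hz⟩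
    · exact ⟨x, .refl, not_exists.1 hx⟩

theorem exists_wordRaises_and_forall_wordDominantFor (w : List ℕ) :
    ∃ w', WordRaises w w' ∧ ∀ i, WordDominantFor i w' := by
  obtain ⟨w', h, hw'⟩ := exists_isNormalFormOf_of_measure (R := fun w w' => ∃ i, WordRaise i w w')
    List.sum (fun w w' ⟨i, h⟩ => by have := h.sum_eq; omega) w
  exact ⟨w', h, fun i => wordDominantFor_iff_forall_not_wordRaise.2 fun v hv => hw' v ⟨i, hv⟩⟩

/-! Throughout, `R` and `L` stand for the parts of a row, read from right to left, that lie to the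
right and to the left of some column; `R'` and `L'` for those of the next row. -/

namespace KnuthEquiv

theorem cons_cons_append {y z : ℕ} {R : List ℕ} (hyz : y < z) (hR : (y :: R).Pairwise (· ≥ ·)) :
    KnuthEquiv (y :: z :: R) (y :: (R ++ [z])) := by
  induction R generalizing y with
  | nil => exact .refl _
  | cons x R ih =>
    have hxy : x ≤ y := List.rel_of_pairwise_cons hR List.mem_cons_self
    calc y :: z :: x :: R
      KnuthEquiv _ (y :: x :: z :: R) := .rel _ _ (.witness_left [] R hxy hyz)
      KnuthEquiv _ (y :: x :: (R ++ [z])) := (ih (hxy.trans_lt hyz) hR.of_cons).cons y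

theorem cons_append_append {c : ℕ} {R P R' : List ℕ} (hRP : R.Forall₂ (· < ·) P)
    (hPR' : P.Sublist R') (hR' : (c :: R').Pairwise (· ≥ ·)) :
    KnuthEquiv (c :: (R ++ R')) (R ++ c :: R') := by
  induction R generalizing c P R' with
  | nil => exact .refl _
  | cons x S ih =>
    obtain ⟨p, Q, hxp, hSQ, rfl⟩ := List.forall₂_cons_left_iff.1 hRP
    obtain ⟨y, S', rfl⟩ := List.exists_cons_of_ne_nil
      (List.ne_nil_of_length_pos (hPR'.length_le.trans_lt' (Nat.succ_pos _)))
    have hQS' : Q.Sublist S' := hPR'.tail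
    have hpy : p ≤ y := by
      rcases List.mem_cons.1 (hPR'.subset List.mem_cons_self) with rfl | hp
      · rfl
      · exact List.rel_of_pairwise_cons hR'.of_cons hp
    have hyc : y ≤ c := List.rel_of_pairwise_cons hR' List.mem_cons_self
    have swap_y := ih hSQ hQS' hR'.of_cons
    calc c :: x :: (S ++ y :: S')
      KnuthEquiv _ (c :: x :: y :: (S ++ S')) := (swap_y.symm.cons x).cons c
      KnuthEquiv _ (x :: c :: y :: (S ++ S')) :=
        .symm (.rel _ _ (.witness_right [] (S ++ S') (hxp.trans_le hpy) hyc))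
      KnuthEquiv _ (x :: c :: (S ++ y :: S')) := (swap_y.cons c).cons x
      KnuthEquiv _ (x :: (S ++ c :: y :: S')) := (ih hSQ (hQS'.cons y) hR').cons x

theorem append_append_comm {R L R' : List ℕ} (hRR' : R.Forall₂ (· < ·) R')
    (hRL : (R ++ L).Pairwise (· ≥ ·)) : KnuthEquiv (R ++ L ++ R') (R ++ R' ++ L) := by
  induction hRR' with
  | nil => simpa using KnuthEquiv.refl L
  | @cons x y S S' hxy _ ih =>
    have hS : (x :: S).Pairwise (· ≥ ·) := (List.pairwise_append.1 hRL).1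
    calc x :: (S ++ L) ++ y :: S'
      KnuthEquiv _ (x :: y :: (S ++ L) ++ S') := by
        simpa using (cons_cons_append hxy hRL).symm.append_right S'
      KnuthEquiv _ (x :: y :: (S ++ S') ++ L) := by
        simpa using ((ih hRL.of_cons).cons y).cons x
      KnuthEquiv _ (x :: (S ++ y :: S') ++ L) := by
        simpa using (cons_cons_append hxy hS).append_right (S' ++ L)

theorem move_up {R L R' L' : List ℕ} {y : ℕ} (hRR' : R.Forall₂ (· < ·) R')
    (hLL' : L.Forall₂ (· < ·) L') (hRyL : (R ++ y :: L).Pairwise (· ≥ ·))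
    (hyL' : (y :: L').Pairwise (· ≥ ·)) :
    KnuthEquiv (R ++ L ++ (R' ++ y :: L')) (R ++ y :: L ++ (R' ++ L')) :=
  have hRL : (R ++ L).Pairwise (· ≥ ·) :=
    hRyL.sublist ((List.Sublist.refl R).append (List.sublist_cons_self y L))
  calc R ++ L ++ (R' ++ y :: L')
    KnuthEquiv _ (R ++ R' ++ (L ++ y :: L')) := by
      simpa using (append_append_comm hRR' hRL).append_right (y :: L')
    KnuthEquiv _ (R ++ R' ++ (y :: (L ++ L'))) :=
      (cons_append_append hLL' (List.Sublist.refl L') hyL').symm.append_left (R ++ R')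
    KnuthEquiv _ (R ++ y :: L ++ (R' ++ L')) := by
      simpa using (append_append_comm hRR' hRyL).symm.append_right L'

end KnuthEquiv

section Matching

variable {α : Type*} {p m : ℕ} {f : α → ℕ} {P : α → α → Prop} {a b c : α} {l : List α}

/-- The letter `f a` is `p` or `m`, and the relation `P` does not pair `a` with any element. -/
def IsUnpaired (p m : ℕ) (f : α → ℕ) (P : α → α → Prop) (a : α) : Prop :=
  (f a = p ∨ f a = m) ∧ ∀ b, ¬ P a b ∧ ¬ P b a

theorem isUnpaired_swap : IsUnpaired m p f (fun b a => P a b) a ↔ IsUnpaired p m f P a := by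
  simp only [IsUnpaired, or_comm, and_comm]

open Classical in
/-- The elements of `l` whose partners `b` are missing from `l`. -/
noncomputable def openElements (P : α → α → Prop) (l : List α) : Finset α :=
  {a ∈ l.toFinset | ∃ b, P a b ∧ b ∉ l}

theorem mem_openElements : a ∈ openElements P l ↔ a ∈ l ∧ ∃ b, P a b ∧ b ∉ l := by
  simp [openElements]

/-- `P` pairs letters `p` of the word `l.map f` with letters `m` to their left, in such a way that
no unpaired letter `p` or `m` lies between the members of a pair. The partner of a letter `p` may be
missing from `l`; it then counts as lying to the left of `l`. -/
structure IsMatching (p m : ℕ) (f : α → ℕ) (P : α → α → Prop) (l : List α) : Prop where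
  nodup : l.Nodup
  letters : ∀ ⦃a b⦄, P a b → f a = p ∧ f b = m
  right_unique : ∀ ⦃a b b'⦄, P a b → P a b' → b = b'
  left_unique : ∀ ⦃a a' b⦄, P a b → P a' b → a = a'
  closed : ∀ ⦃a b⦄, P a b → b ∈ l → a ∈ l
  order : l.Pairwise fun b a => ¬ P b a
  enclosed : ∀ ⦃c l'⦄, c :: l' <:+ l → IsUnpaired p m f P c → openElements P l' = ∅

namespace IsMatching

theorem of_cons (h : IsMatching p m f P (c :: l)) : IsMatching p m f P l where
  nodup := h.nodup.of_cons
  letters := h.letters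
  right_unique := h.right_unique
  left_unique := h.left_unique
  closed a b hab hb := by
    rcases List.mem_cons.1 (h.closed hab (List.mem_cons_of_mem c hb)) with rfl | ha
    · exact absurd hab (List.rel_of_pairwise_cons h.order hb)
    · exact ha
  order := h.order.of_cons
  enclosed _ _ hl := h.enclosed (hl.trans (List.suffix_cons c l))

theorem card_openElements_cons_of_left (h : IsMatching p m f P (c :: l)) (hpm : p ≠ m)
    (hc : P c b) : (openElements P (c :: l)).card = (openElements P l).card + 1 := by
  classical
  have hcl : c ∉ l := h.nodup.notMem
  have hb : b ∉ c :: l := by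
    rw [List.mem_cons]
    rintro (rfl | hb)
    · exact hpm ((h.letters hc).1.symm.trans (h.letters hc).2)
    · exact List.rel_of_pairwise_cons h.order hb hc
  have : openElements P (c :: l) = insert c (openElements P l) := by
    ext a
    have : P a c → f c = p ∧ f c = m := fun hac => ⟨(h.letters hc).1, (h.letters hac).2⟩
    simp only [mem_openElements, Finset.mem_insert, List.mem_cons] at hb ⊢
    grind
  rw [this, Finset.card_insert_of_notMem (by simp [mem_openElements, hcl])]

theorem card_openElements_cons_of_right (h : IsMatching p m f P (c :: l)) (hpm : p ≠ m)
    (hc : P a c) : (openElements P l).card = (openElements P (c :: l)).card + 1 := by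
  classical
  have hcl : c ∉ l := h.nodup.notMem
  have hal : a ∈ l := by
    rcases List.mem_cons.1 (h.closed hc List.mem_cons_self) with rfl | ha
    · exact absurd ((h.letters hc).1.symm.trans (h.letters hc).2) hpm
    · exact ha
  have ha : a ∉ openElements P (c :: l) := by
    rw [mem_openElements]
    rintro ⟨-, b, hab, hb⟩
    exact hb (h.right_unique hc hab ▸ List.mem_cons_self)
  have : openElements P l = insert a (openElements P (c :: l)) := by
    ext a'
    have : P a' c → a' = a := fun h' => h.left_unique h' hc
    have : ∀ b, P c b → f c = p ∧ f c = m := fun b hcb => ⟨(h.letters hcb).1, (h.letters hc).2⟩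
    simp only [mem_openElements, Finset.mem_insert, List.mem_cons]
    grind
  rw [this, Finset.card_insert_of_notMem ha]

theorem openElements_cons_of_not (hc : ∀ b, ¬ P c b ∧ ¬ P b c) :
    openElements P (c :: l) = openElements P l := by
  ext a
  simp only [mem_openElements, List.mem_cons]
  grind

open Classical in
theorem pending_map_eq (h : IsMatching p m f P l) (hpm : p ≠ m) :
    pending p m 0 (l.map f) =
      pending p m 0 ((l.filter fun c => IsUnpaired p m f P c).map f) + (openElements P l).card := by
  induction l with
  | nil => simp [openElements]
  | cons c l ih =>
    rw [List.map_cons, pending_cons, ih h.of_cons]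
    by_cases unpaired : IsUnpaired p m f P c
    · rw [List.filter_cons_of_pos (by simpa using unpaired), List.map_cons, pending_cons,
        openElements_cons_of_not unpaired.2, h.enclosed (List.suffix_refl _) unpaired]
      rfl
    rw [List.filter_cons_of_neg (by simpa using unpaired)]
    by_cases left : ∃ b, P c b
    · obtain ⟨b, hc⟩ := left
      rw [h.card_openElements_cons_of_left hpm hc, (h.letters hc).1, matchStep, if_pos rfl,
        add_assoc]
    by_cases right : ∃ a, P a c
    · obtain ⟨a, hc⟩ := right
      rw [h.card_openElements_cons_of_right hpm hc, (h.letters hc).2, matchStep,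
        if_neg hpm.symm, if_pos rfl]
      rfl
    · rw [openElements_cons_of_not (by grind), matchStep, if_neg, if_neg] <;>
        grind [IsUnpaired]

end IsMatching

end Matching

/-- The square `c` equals `d` or comes before `d` in every valid reading order. -/
def Precedes (c d : ℕ × ℕ) : Prop := c.1 ≤ d.1 ∧ d.2 ≤ c.2

theorem SkewShape.mem_cells_of_le_of_le {χ : SkewShape} {c d e : ℕ × ℕ} (hc : c ∈ χ.cells)
    (hd : d ∈ χ.cells) (hce : c ≤ e) (hed : e ≤ d) : e ∈ χ.cells := by
  simp only [SkewShape.cells, Finset.mem_sdiff, YoungDiagram.mem_cells] at *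
  exact ⟨χ.outer.up_left_mem hed.1 hed.2 hd.1, fun he => hc.2 (χ.inner.up_left_mem hce.1 hce.2 he)⟩

namespace SkewTableau

variable {χ : SkewShape} (T : SkewTableau χ) {i : ℕ} {c d : ℕ × ℕ}

theorem entry_add_le (hc : c ∈ χ.cells) (hd : d ∈ χ.cells) (hcd : c ≤ d) :
    T.entry c + d.1 ≤ T.entry d + c.1 := by
  obtain ⟨a, b⟩ := c
  obtain ⟨a', b'⟩ := d
  obtain ⟨haa', hbb'⟩ : a ≤ a' ∧ b ≤ b' := hcd
  induction a', haa' using Nat.le_induction with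
  | base =>
    rcases hbb'.eq_or_lt with rfl | hbb'
    · rfl
    · exact Nat.add_le_add_right (T.row_weak a b b' hbb' hc hd) a
  | succ a' haa' ih =>
    have he : (a', b') ∈ χ.cells :=
      SkewShape.mem_cells_of_le_of_le hc hd ⟨haa', hbb'⟩ ⟨a'.le_succ, le_rfl⟩
    have := ih he
    have := T.col_strict a' (a' + 1) b' a'.lt_succ_self he hd
    omega

/-- The square `c` is directly above `d`, and contains `i` while `d` contains `i + 1`. -/
structure IsVerticalPair (i : ℕ) (c d : ℕ × ℕ) : Prop where
  left_mem : c ∈ χ.cells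
  right_mem : d ∈ χ.cells
  fst_eq : d.1 = c.1 + 1
  snd_eq : d.2 = c.2
  left_entry : T.entry c = i
  right_entry : T.entry d = i + 1

/-- The square `c` contains `i` or `i + 1` and does not belong to a vertical pair. Only the contents
of these squares matter for the raising operation for `i`. -/
def IsFree (i : ℕ) (c : ℕ × ℕ) : Prop :=
  c ∈ χ.cells ∧ IsUnpaired i (i + 1) T.entry (T.IsVerticalPair i) c

variable {T} {e : ℕ × ℕ}

theorem IsFree.precedes_or_precedes (hc : T.IsFree i c) (hd : T.IsFree i d) :
    Precedes c d ∨ Precedes d c := by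
  wlog hcd : c.1 < d.1 generalizing c d
  · simp only [Precedes] at this ⊢
    rcases (not_lt.1 hcd).eq_or_lt with h | h
    · omega
    · exact (this hd hc h).symm
  by_contra h
  obtain ⟨⟨a, b⟩, ⟨a', b'⟩⟩ := c, d
  simp only [Precedes, not_or, not_and, not_le] at h hcd
  have hce : (a, b) ≤ (a, b') := ⟨le_rfl, (h.1 hcd.le).le⟩
  have hed : (a, b') ≤ (a', b') := ⟨hcd.le, le_rfl⟩
  have he : (a, b') ∈ χ.cells := SkewShape.mem_cells_of_le_of_le hc.1 hd.1 hce hed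
  have hce' := T.entry_add_le hc.1 he hce
  have hed' := T.entry_add_le he hd.1 hed
  have := hc.2.1
  have := hd.2.1
  exact (hd.2.2 (a, b')).2 ⟨he, hd.1, by grind, rfl, by grind, by grind⟩

theorem IsVerticalPair.precedes (h : T.IsVerticalPair i c d) : Precedes c d :=
  ⟨h.fst_eq ▸ c.1.le_succ, h.snd_eq.le⟩

theorem IsVerticalPair.right_unique (h : T.IsVerticalPair i c d) (h' : T.IsVerticalPair i c e) :
    d = e :=
  Prod.ext (h.fst_eq.trans h'.fst_eq.symm) (h.snd_eq.trans h'.snd_eq.symm)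

theorem IsVerticalPair.left_unique (h : T.IsVerticalPair i c e) (h' : T.IsVerticalPair i d e) :
    c = d :=
  Prod.ext (Nat.succ_injective (h.fst_eq.symm.trans h'.fst_eq)) (h.snd_eq.symm.trans h'.snd_eq)

theorem IsVerticalPair.precedes_or_precedes (h : T.IsVerticalPair i c d) (he : T.IsFree i e) :
    Precedes e c ∨ Precedes d e := by
  obtain ⟨⟨a, b⟩, ⟨a', b'⟩, ⟨x, y⟩⟩ := c, d, e
  obtain ⟨hc, hd, ha', hb', hTc, hTd⟩ := h
  obtain rfl : a' = a + 1 := ha'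
  obtain rfl : b' = b := hb'
  by_contra hne
  simp only [Precedes, not_or, not_and, not_le] at hne
  have := he.2.1
  rcases le_or_gt x a with hxa | hax
  · have hyb := hne.1 hxa
    have hed : (x, y) ≤ (a + 1, b') := ⟨by simp only; omega, hyb.le⟩
    have hed' := T.entry_add_le he.1 hd hed
    obtain rfl : x = a := by simp only at hed'; omega
    have := T.entry_add_le he.1 hc ⟨le_rfl, hyb.le⟩
    have hf : (x + 1, y) ∈ χ.cells :=
      SkewShape.mem_cells_of_le_of_le he.1 hd ⟨x.le_succ, le_rfl⟩ ⟨le_rfl, hyb.le⟩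
    have hef := T.entry_add_le he.1 hf ⟨x.le_succ, le_rfl⟩
    have hfd := T.entry_add_le hf hd ⟨le_rfl, hyb.le⟩
    exact (he.2.2 (x + 1, y)).1 ⟨he.1, hf, rfl, rfl, by grind, by grind⟩
  · have hby := hne.2 hax
    have hce := T.entry_add_le hc he.1 ⟨hax.le, hby.le⟩
    obtain rfl : x = a + 1 := by simp only at hce; omega
    have hf : (a, y) ∈ χ.cells :=
      SkewShape.mem_cells_of_le_of_le hc he.1 ⟨le_rfl, hby.le⟩ ⟨a.le_succ, le_rfl⟩
    have hcf := T.entry_add_le hc hf ⟨le_rfl, hby.le⟩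
    have hfe := T.entry_add_le hf he.1 ⟨a.le_succ, le_rfl⟩
    exact (he.2.2 (a, y)).2 ⟨hf, he.1, rfl, rfl, by grind, by grind⟩

end SkewTableau

namespace ReadingOrder

variable {χ : SkewShape} {T : SkewTableau χ} {r : ReadingOrder χ} {u v : List (ℕ × ℕ)} {i : ℕ}
  {c d e : ℕ × ℕ}

theorem not_precedes (h : r.squares = u ++ v) (hc : c ∈ u) (hd : d ∈ v) : ¬ Precedes d c :=
  (List.pairwise_append.1 (h ▸ r.valid)).2.2 c hc d hd

theorem mem_of_precedes (h : r.squares = u ++ v) (hc : c ∈ χ.cells) (hcd : Precedes c d)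
    (hd : d ∈ u) : c ∈ u := by
  have hc := (r.mem_squares c).2 hc
  rw [h, List.mem_append] at hc
  exact hc.resolve_right fun hc => not_precedes h hd hc hcd

theorem disjoint (h : r.squares = u ++ v) : u.Disjoint v :=
  List.disjoint_of_nodup_append (h ▸ r.nodup)

theorem mem_iff_mem_of_isVerticalPair (h : r.squares = u ++ e :: v) (he : T.IsFree i e)
    (hcd : T.IsVerticalPair i c d) : c ∈ u ↔ d ∈ u := by
  refine ⟨fun hc => ?_, mem_of_precedes h hcd.left_mem hcd.precedes⟩
  have hde : Precedes d e := (hcd.precedes_or_precedes he).resolve_left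
    (not_precedes h hc List.mem_cons_self)
  have hd := (r.mem_squares d).2 hcd.right_mem
  rw [h, List.mem_append, List.mem_cons] at hd
  rcases hd with hd | rfl | hd
  · exact hd
  · exact absurd hcd (he.2.2 c).2
  · exact absurd hde (not_precedes (u := u ++ [e]) (by simpa using h) (by simp) hd)

theorem isMatching_right (h : r.squares = u ++ v) :
    IsMatching (i + 1) i T.entry (fun d c => T.IsVerticalPair i c d) v where
  nodup := (List.nodup_append.1 (h ▸ r.nodup)).2.1
  letters _ _ hcd := ⟨hcd.right_entry, hcd.left_entry⟩
  right_unique _ _ _ h h' := h.left_unique h'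
  left_unique _ _ _ h h' := h.right_unique h'
  closed d c hcd hc := by
    have hd := (r.mem_squares d).2 hcd.right_mem
    rw [h, List.mem_append] at hd
    exact hd.resolve_left fun hd => disjoint h (mem_of_precedes h hcd.left_mem hcd.precedes hd) hc
  order := (List.pairwise_append.1 (h ▸ r.valid)).2.1.imp fun h hcd => h hcd.precedes
  enclosed e l hl he := by
    obtain ⟨w, rfl⟩ := hl
    rw [← List.append_assoc] at h
    rw [isUnpaired_swap] at he
    have he_free : T.IsFree i e := ⟨(r.mem_squares e).1 (by simp [h]), he⟩
    refine Finset.eq_empty_of_forall_notMem fun d hd => ?_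
    obtain ⟨hd, c, hcd, hc⟩ := mem_openElements.1 hd
    have hc' := (r.mem_squares c).2 hcd.left_mem
    rw [h, List.mem_append, List.mem_cons] at hc'
    rcases hc' with hc' | rfl | hc'
    · exact disjoint h ((mem_iff_mem_of_isVerticalPair h he_free hcd).1 hc')
        (List.mem_cons_of_mem e hd)
    · exact (he.2 d).1 hcd
    · exact hc hc'

theorem isMatching_left (h : r.squares = u ++ v) :
    IsMatching i (i + 1) T.entry (T.IsVerticalPair i) u.reverse where
  nodup := List.nodup_reverse.2 (List.nodup_append.1 (h ▸ r.nodup)).1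
  letters _ _ hcd := ⟨hcd.left_entry, hcd.right_entry⟩
  right_unique _ _ _ h h' := h.right_unique h'
  left_unique _ _ _ h h' := h.left_unique h'
  closed c d hcd := by
    simpa only [List.mem_reverse] using mem_of_precedes h hcd.left_mem hcd.precedes
  order := List.pairwise_reverse.2
    ((List.pairwise_append.1 (h ▸ r.valid)).1.imp fun h hcd => h hcd.precedes)
  enclosed e l hl he := by
    obtain ⟨w, hw⟩ := hl
    obtain rfl : u = l.reverse ++ e :: w.reverse := by
      rw [← u.reverse_reverse, ← hw]
      simp
    rw [List.append_assoc] at h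
    have he_free : T.IsFree i e := ⟨(r.mem_squares e).1 (by simp [h]), he⟩
    refine Finset.eq_empty_of_forall_notMem fun c hc => ?_
    obtain ⟨hc, d, hcd, hd⟩ := mem_openElements.1 hc
    exact hd (by simpa [hc] using mem_iff_mem_of_isVerticalPair h he_free hcd)

open Classical in
theorem wordDominantFor_map_iff (h : r.squares = u ++ v) :
    WordDominantFor i (v.map T.entry) ↔ WordDominantFor i ((v.filter (T.IsFree i)).map T.entry) ∧
      openElements (fun d c => T.IsVerticalPair i c d) v = ∅ := by
  have hfree : v.filter (T.IsFree i) = v.filter fun c =>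
      IsUnpaired (i + 1) i T.entry (fun d c => T.IsVerticalPair i c d) c :=
    List.filter_congr fun c hc => by
      simp [SkewTableau.IsFree, isUnpaired_swap, ← r.mem_squares, h, hc]
  simp only [wordDominantFor_iff_pending, (isMatching_right h).pending_map_eq i.succ_ne_self, hfree,
    Nat.add_eq_zero_iff, Finset.card_eq_zero]

open Classical in
theorem wordAntiDominantFor_map_iff (h : r.squares = u ++ v) :
    WordAntiDominantFor i (u.map T.entry) ↔
      WordAntiDominantFor i ((u.filter (T.IsFree i)).map T.entry) ∧
      openElements (T.IsVerticalPair i) u.reverse = ∅ := by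
  have hfree : u.reverse.filter (T.IsFree i) = u.reverse.filter fun c =>
      IsUnpaired i (i + 1) T.entry (T.IsVerticalPair i) c :=
    List.filter_congr fun c hc => by
      simp [SkewTableau.IsFree, ← r.mem_squares, h, List.mem_reverse.1 hc]
  simp only [wordAntiDominantFor_iff_pending, ← List.map_reverse, ← List.filter_reverse,
    (isMatching_left h).pending_map_eq i.succ_ne_self.symm, hfree, Nat.add_eq_zero_iff,
    Finset.card_eq_zero]

variable (r) in
/-- The word with letters `f c` is anti-dominant for `i` before the square `x` and dominant for `i`
after it. So a raising operation changes the letter of `x` if it is `i + 1`, and produces it if it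
is `i`. -/
def IsPivot (f : ℕ × ℕ → ℕ) (i : ℕ) (x : ℕ × ℕ) : Prop :=
  ∃ u v, r.squares = u ++ x :: v ∧ WordAntiDominantFor i (u.map f) ∧ WordDominantFor i (v.map f)

variable {x : ℕ × ℕ}

theorem IsPivot.isFree (h : r.IsPivot T.entry i x) (hx : T.entry x = i ∨ T.entry x = i + 1) :
    T.IsFree i x := by
  obtain ⟨u, v, h, hu, hv⟩ := h
  have h' : r.squares = (u ++ [x]) ++ v := by simpa using h
  refine ⟨(r.mem_squares x).1 (by simp [h]), hx, fun y => ⟨fun hxy => ?_, fun hyx => ?_⟩⟩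
  · have hxv : x ∉ v := fun hxv => disjoint h' (by simp) hxv
    have hyv : y ∈ v := by
      have hy := (r.mem_squares y).2 hxy.right_mem
      rw [h', List.mem_append] at hy
      refine hy.resolve_left fun hy => ?_
      rcases List.mem_append.1 hy with hy | hy
      · exact disjoint h (mem_of_precedes h hxy.left_mem hxy.precedes hy) List.mem_cons_self
      · have := hxy.fst_eq
        simp_all
    have hy := (mem_openElements (P := fun d c => T.IsVerticalPair i c d)).2 ⟨hyv, x, hxy, hxv⟩
    simp [((wordDominantFor_map_iff h').1 hv).2] at hy
  · have hxu : x ∉ u := fun hxu => disjoint h hxu List.mem_cons_self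
    have hyu : y ∈ u := by
      have hy := mem_of_precedes h' hyx.left_mem hyx.precedes (by simp)
      have := hyx.fst_eq
      rcases List.mem_append.1 hy with hy | hy
      · exact hy
      · simp_all
    have hy := mem_openElements.2 ⟨List.mem_reverse.2 hyu, x, hyx, by simpa using hxu⟩
    simp [((wordAntiDominantFor_map_iff h).1 hu).2] at hy

open Classical in
theorem isPivot_iff (hx : T.entry x = i ∨ T.entry x = i + 1) : r.IsPivot T.entry i x ↔
    ∃ u v, r.squares.filter (T.IsFree i) = u ++ x :: v ∧ WordAntiDominantFor i (u.map T.entry) ∧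
      WordDominantFor i (v.map T.entry) := by
  constructor
  · intro h
    have hx := h.isFree hx
    obtain ⟨u, v, h, hu, hv⟩ := h
    rw [wordAntiDominantFor_map_iff h] at hu
    rw [wordDominantFor_map_iff (u := u ++ [x]) (by simpa using h)] at hv
    exact ⟨_, _, by simp [h, hx], hu.1, hv.1⟩
  · rintro ⟨u', v', h', hu', hv'⟩
    obtain ⟨hx_mem, hx_free⟩ : x ∈ r.squares ∧ T.IsFree i x := by
      simpa using (h' ▸ by simp : x ∈ r.squares.filter (T.IsFree i))
    obtain ⟨u, v, h⟩ := List.append_of_mem hx_mem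
    have h₁ : r.squares = (u ++ [x]) ++ v := by simpa using h
    have hxu : x ∉ u := fun hxu => disjoint h hxu List.mem_cons_self
    have hxv : x ∉ v := fun hxv => disjoint h₁ (by simp) hxv
    rw [h, List.filter_append, List.filter_cons_of_pos (by simpa using hx_free)] at h'
    obtain ⟨rfl, -, rfl⟩ := (List.append_cons_inj_of_notMem
      (fun h => hxu (List.mem_of_mem_filter h)) fun h => hxv (List.mem_of_mem_filter h)).1 h'
    refine ⟨u, v, h, (wordAntiDominantFor_map_iff h).2 ⟨hu', ?_⟩,
      (wordDominantFor_map_iff h₁).2 ⟨hv', ?_⟩⟩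
    · exact (isMatching_left h₁).enclosed (by simp) hx_free.2
    · exact (isMatching_right h).enclosed (List.suffix_refl _) (isUnpaired_swap.2 hx_free.2)

open Classical in
theorem filter_isFree_eq (r r' : ReadingOrder χ) :
    r.squares.filter (T.IsFree i) = r'.squares.filter (T.IsFree i) := by
  have pairwise_precedes (r : ReadingOrder χ) :
      (r.squares.filter (T.IsFree i)).Pairwise Precedes := by
    refine ((r.valid.filter _).imp_of_mem fun hc hd h => ?_)
    simp only [List.mem_filter, decide_eq_true_eq] at hc hd
    exact (hc.2.precedes_or_precedes hd.2).resolve_right h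
  have perm : r.squares.Perm r'.squares :=
    (List.perm_ext_iff_of_nodup r.nodup r'.nodup).2 fun c => by simp only [mem_squares]
  refine (perm.filter _).eq_of_pairwise (fun c d _ _ hcd hdc => ?_) (pairwise_precedes r)
    (pairwise_precedes r')
  exact Prod.ext (hcd.1.antisymm hdc.1) (hdc.2.antisymm hcd.2)

theorem isPivot_iff_isPivot (r r' : ReadingOrder χ) (hx : T.entry x = i ∨ T.entry x = i + 1) :
    r.IsPivot T.entry i x ↔ r'.IsPivot T.entry i x := by
  rw [isPivot_iff hx, isPivot_iff hx, filter_isFree_eq r r']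

variable {f g : ℕ × ℕ → ℕ}

theorem map_eq_map_iff (h : r.squares = u ++ x :: v) :
    (∀ c ∈ χ.cells, c ≠ x → f c = g c) ↔ u.map f = u.map g ∧ v.map f = v.map g := by
  have hxu : x ∉ u := fun hxu => disjoint h hxu List.mem_cons_self
  have hxv : x ∉ v := fun hxv => disjoint (u := u ++ [x]) (by simpa using h) (by simp) hxv
  simp only [List.map_inj_left, ← r.mem_squares, h, List.mem_append, List.mem_cons]
  grind

theorem IsPivot.congr (h : r.IsPivot f i x) (hfg : ∀ c ∈ χ.cells, c ≠ x → f c = g c) :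
    r.IsPivot g i x := by
  obtain ⟨u, v, h, hu, hv⟩ := h
  obtain ⟨hfu, hfv⟩ := (map_eq_map_iff h).1 hfg
  exact ⟨u, v, h, hfu ▸ hu, hfv ▸ hv⟩

theorem wordRaise_map_iff : WordRaise i (r.squares.map f) (r.squares.map g) ↔
    ∃ x ∈ χ.cells, r.IsPivot f i x ∧ f x = i + 1 ∧ g x = i ∧ ∀ c ∈ χ.cells, c ≠ x → f c = g c := by
  constructor
  · rintro ⟨u', v', hu, hv, hf, hg⟩
    obtain ⟨u, w, h, rfl, hw⟩ := List.map_eq_append_iff.1 hf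
    obtain ⟨x, v, rfl, hx, rfl⟩ := List.map_eq_cons_iff.1 hw
    rw [h, List.map_append, List.map_cons] at hg
    obtain ⟨hgu, hgv⟩ := List.append_inj hg (by simp)
    obtain ⟨hgx, hgv⟩ := List.cons_eq_cons.1 hgv
    exact ⟨x, (r.mem_squares x).1 (by simp [h]), ⟨u, v, h, hu, hv⟩, hx, hgx,
      (map_eq_map_iff h).2 ⟨hgu.symm, hgv.symm⟩⟩
  · rintro ⟨x, -, ⟨u, v, h, hu, hv⟩, hfx, hgx, hfg⟩
    obtain ⟨hfu, hfv⟩ := (map_eq_map_iff h).1 hfg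
    exact ⟨u.map f, v.map f, hu, hv, by simp [h, hfx], by simp [h, hgx, hfu, hfv]⟩

end ReadingOrder

theorem raisingStep_iff_raisingStep {χ : SkewShape} {T U : SkewTableau χ} (r r' : ReadingOrder χ) :
    RaisingStep r T U ↔ RaisingStep r' T U := by
  refine exists_congr fun i => ?_
  simp only [SkewTableau.word, ReadingOrder.wordRaise_map_iff]
  refine exists_congr fun x => and_congr_right fun _ => ?_
  exact ⟨fun ⟨h, hx, h'⟩ => ⟨(ReadingOrder.isPivot_iff_isPivot r r' (.inr hx)).1 h, hx, h'⟩,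
    fun ⟨h, hx, h'⟩ => ⟨(ReadingOrder.isPivot_iff_isPivot r r' (.inr hx)).2 h, hx, h'⟩⟩

theorem SkewShape.pairwise_semitic (χ : SkewShape) :
    χ.semitic.squares.Pairwise fun c d => c.1 < d.1 ∨ c.1 = d.1 ∧ d.2 < c.2 := by
  refine List.pairwise_flatMap.2 ⟨fun i _ => ?_, List.pairwise_lt_range.imp ?_⟩
  · refine (χ.pairwise_revRow i).imp_of_mem fun hc hd h => .inr ⟨?_, h⟩
    rw [((χ.mem_revRow i _).1 hc).1, ((χ.mem_revRow i _).1 hd).1]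
  · intro i j hij c hc d hd
    rw [((χ.mem_revRow i _).1 hc).1, ((χ.mem_revRow j _).1 hd).1]
    exact .inl hij

namespace ReadingOrder

variable {χ : SkewShape} {T : SkewTableau χ} {i : ℕ} {x c d : ℕ × ℕ}

theorem eq_and_eq_of_squares_eq {r : ReadingOrder χ} {u v u' v' : List (ℕ × ℕ)}
    (h : r.squares = u ++ x :: v) (h' : r.squares = u' ++ x :: v') : u = u' ∧ v = v' := by
  have hnodup := List.nodup_middle.1 (h ▸ r.nodup)
  simp only [List.nodup_cons, List.mem_append, not_or] at hnodup
  obtain ⟨hu, -, hv⟩ := (List.append_cons_inj_of_notMem hnodup.1.1 hnodup.1.2).1 (h.symm.trans h')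
  exact ⟨hu, hv⟩

theorem exists_semitic_squares_eq (hc : c ∈ χ.cells) (hd : d ∈ χ.cells) (hcd : c.1 = d.1)
    (hcd' : c.2 < d.2) : ∃ u m v, χ.semitic.squares = u ++ d :: m ++ c :: v ∧
      ∀ z ∈ m, z.1 = c.1 ∧ c.2 < z.2 ∧ z.2 < d.2 := by
  obtain ⟨u, v, h⟩ := List.append_of_mem ((χ.semitic.mem_squares d).2 hd)
  have sorted := χ.pairwise_semitic
  have hc' := (χ.semitic.mem_squares c).2 hc
  rw [h] at hc' sorted
  simp only [List.pairwise_append, List.pairwise_cons, List.mem_append, List.mem_cons] at sorted hc'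
  have hcv : c ∈ v := by
    rcases hc' with hc' | rfl | hc'
    · have := sorted.2.2 c hc' d (.inl rfl)
      omega
    · exact absurd hcd' (lt_irrefl _)
    · exact hc'
  obtain ⟨m, n, rfl⟩ := List.append_of_mem hcv
  refine ⟨u, m, n, by simpa using h, fun z hz => ?_⟩
  have hdz := sorted.2.1.1 z (by simp [hz])
  have hzc := (List.pairwise_append.1 sorted.2.1.2).2.2 z hz c List.mem_cons_self
  omega

theorem exists_semitic_squares_eq_of_entry_eq (hc : c ∈ χ.cells) (hd : d ∈ χ.cells)
    (hcd : c.1 = d.1) (hcd' : c.2 < d.2) (hTcd : T.entry c = T.entry d) :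
    ∃ u m v, χ.semitic.squares = u ++ d :: m ++ c :: v ∧ ∀ z ∈ m, T.entry z = T.entry c := by
  obtain ⟨u, m, v, h, hm⟩ := exists_semitic_squares_eq hc hd hcd hcd'
  refine ⟨u, m, v, h, fun z hz => ?_⟩
  have hzχ : z ∈ χ.cells := (χ.semitic.mem_squares z).1 (by simp [h, hz])
  have hz' := hm z hz
  have hTcz := T.entry_add_le hc hzχ ⟨by omega, by omega⟩
  have hTzd := T.entry_add_le hzχ hd ⟨by omega, by omega⟩
  omega

theorem IsPivot.entry_ne_of_left (h : χ.semitic.IsPivot T.entry i x) (hx : T.entry x = i + 1)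
    (hxχ : x ∈ χ.cells) (hc : c ∈ χ.cells) (hcx : c.1 = x.1) (hcx' : c.2 < x.2) :
    T.entry c ≠ i + 1 := by
  intro hTc
  obtain ⟨u, m, v, h', hm⟩ :=
    exists_semitic_squares_eq_of_entry_eq hc hxχ hcx hcx' (hTc.trans hx.symm)
  obtain ⟨u', v', h, -, hv⟩ := h
  obtain ⟨-, rfl⟩ := eq_and_eq_of_squares_eq (by simpa using h') h
  have hm : m.map T.entry = List.replicate m.length (i + 1) :=
    (List.map_congr_left hm).trans (by rw [hTc, List.map_const'])
  simpa [hm, hTc, List.count_replicate] using hv ((m ++ [c]).map T.entry) ⟨v.map T.entry, by simp⟩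

theorem IsPivot.entry_ne_of_right (h : χ.semitic.IsPivot T.entry i x) (hx : T.entry x = i)
    (hxχ : x ∈ χ.cells) (hc : c ∈ χ.cells) (hcx : c.1 = x.1) (hcx' : x.2 < c.2) :
    T.entry c ≠ i := by
  intro hTc
  obtain ⟨u, m, v, h', hm⟩ :=
    exists_semitic_squares_eq_of_entry_eq hxχ hc hcx.symm hcx' (hx.trans hTc.symm)
  obtain ⟨u', v', h, hu, -⟩ := h
  obtain ⟨rfl, -⟩ := eq_and_eq_of_squares_eq h' h
  have hm : m.map T.entry = List.replicate m.length i :=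
    (List.map_congr_left hm).trans (by rw [hx, List.map_const'])
  simpa [hm, hTc, List.count_replicate] using hu ((c :: m).map T.entry) ⟨u.map T.entry, by simp⟩

theorem IsPivot.exists_entry_eq_update_of_eq_succ (h : χ.semitic.IsPivot T.entry i x)
    (hx : T.entry x = i + 1) (hxχ : x ∈ χ.cells) :
    ∃ U : SkewTableau χ, U.entry = Function.update T.entry x i := by
  have hfree := h.isFree (.inr hx)
  refine ⟨⟨Function.update T.entry x i, fun a b b' hbb' hc hd => ?_, fun a a' b haa' hc hd => ?_,
    fun c hc => ?_⟩, rfl⟩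
  · have hTcd := T.row_weak a b b' hbb' hc hd
    rcases eq_or_ne (a, b') x with rfl | hdx
    · have := h.entry_ne_of_left hx hxχ hc rfl hbb'
      grind
    · grind
  · have hTcd := T.col_strict a a' b haa' hc hd
    rcases eq_or_ne (a', b) x with rfl | hdx
    · have hle := T.entry_add_le hc hd ⟨haa'.le, le_rfl⟩
      have : T.entry (a, b) ≠ i := fun hTc =>
        (hfree.2.2 (a, b)).2 ⟨hc, hd, by grind, rfl, hTc, hx⟩
      grind
    · grind
  · rw [Function.update_of_ne (by grind), T.zeros c hc]

theorem IsPivot.exists_entry_eq_update_of_eq (h : χ.semitic.IsPivot T.entry i x)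
    (hx : T.entry x = i) (hxχ : x ∈ χ.cells) :
    ∃ U : SkewTableau χ, U.entry = Function.update T.entry x (i + 1) := by
  have hfree := h.isFree (.inl hx)
  refine ⟨⟨Function.update T.entry x (i + 1), fun a b b' hbb' hc hd => ?_,
    fun a a' b haa' hc hd => ?_, fun c hc => ?_⟩, rfl⟩
  · have hTcd := T.row_weak a b b' hbb' hc hd
    rcases eq_or_ne (a, b) x with rfl | hcx
    · have := h.entry_ne_of_right hx hxχ hd rfl hbb'
      grind
    · grind
  · have hTcd := T.col_strict a a' b haa' hc hd
    rcases eq_or_ne (a, b) x with rfl | hcx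
    · have hle := T.entry_add_le hc hd ⟨haa'.le, le_rfl⟩
      have : T.entry (a', b) ≠ i + 1 := fun hTd =>
        (hfree.2.2 (a', b)).1 ⟨hc, hd, by grind, rfl, hx, hTd⟩
      grind
    · grind
  · rw [Function.update_of_ne (by grind), T.zeros c hc]

theorem map_update_eq {r : ReadingOrder χ} {u v : List (ℕ × ℕ)} (h : r.squares = u ++ x :: v)
    (f : ℕ × ℕ → ℕ) (k : ℕ) :
    r.squares.map (Function.update f x k) = u.map f ++ k :: v.map f := by
  obtain ⟨hu, hv⟩ := (map_eq_map_iff h).1 fun c _ hcx => (Function.update_of_ne hcx k f).symm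
  rw [h, List.map_append, List.map_cons, Function.update_self, hu, hv]

end ReadingOrder

namespace SkewTableau

variable {χ : SkewShape} {T U : SkewTableau χ} {r : ReadingOrder χ} {i : ℕ} {w : List ℕ}

/-- The word of `T` in the Semitic reading order is dominant for every letter. -/
def IsDominant (T : SkewTableau χ) : Prop := ∀ i, WordDominantFor i (T.word χ.semitic)

theorem word_injective : Function.Injective fun T : SkewTableau χ => T.word r := by
  intro T U h
  ext c
  by_cases hc : c ∈ χ.cells
  · exact List.map_inj_left.1 h c ((r.mem_squares c).2 hc)
  · rw [T.zeros c hc, U.zeros c hc]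

theorem exists_squares_eq_of_word_eq {u' v' : List ℕ} {k : ℕ} (h : T.word r = u' ++ k :: v') :
    ∃ u x v, r.squares = u ++ x :: v ∧ u.map T.entry = u' ∧ T.entry x = k ∧
      v.map T.entry = v' ∧ x ∈ χ.cells := by
  obtain ⟨u, w, h, hu, hw⟩ := List.map_eq_append_iff.1 h
  obtain ⟨x, v, rfl, hx, hv⟩ := List.map_eq_cons_iff.1 hw
  exact ⟨u, x, v, h, hu, hx, hv, (r.mem_squares x).1 (by simp [h])⟩

theorem exists_word_eq_of_wordRaise (h : WordRaise i (T.word χ.semitic) w) :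
    ∃ U : SkewTableau χ, U.word χ.semitic = w := by
  obtain ⟨u', v', hu, hv, hT, rfl⟩ := h
  obtain ⟨u, x, v, h, rfl, hx, rfl, hxχ⟩ := exists_squares_eq_of_word_eq hT
  obtain ⟨U, hU⟩ := ReadingOrder.IsPivot.exists_entry_eq_update_of_eq_succ ⟨u, v, h, hu, hv⟩ hx hxχ
  exact ⟨U, by rw [word, hU, ReadingOrder.map_update_eq h]⟩

theorem exists_word_eq_of_wordRaise_word (h : WordRaise i w (U.word χ.semitic)) :
    ∃ T : SkewTableau χ, T.word χ.semitic = w := by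
  obtain ⟨u', v', hu, hv, rfl, hU⟩ := h
  obtain ⟨u, x, v, h, rfl, hx, rfl, hxχ⟩ := exists_squares_eq_of_word_eq hU
  obtain ⟨T, hT⟩ := ReadingOrder.IsPivot.exists_entry_eq_update_of_eq ⟨u, v, h, hu, hv⟩ hx hxχ
  exact ⟨T, by rw [word, hT, ReadingOrder.map_update_eq h]⟩

theorem exists_word_eq_of_wordRaises (h : WordRaises (T.word χ.semitic) w) :
    ∃ U : SkewTableau χ, U.word χ.semitic = w := by
  induction h with
  | refl => exact ⟨T, rfl⟩
  | tail _ h ih =>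
    obtain ⟨U, rfl⟩ := ih
    exact exists_word_eq_of_wordRaise h.choose_spec

theorem exists_word_eq_of_wordRaises_word (h : WordRaises w (U.word χ.semitic)) :
    ∃ T : SkewTableau χ, T.word χ.semitic = w := by
  induction h using Relation.ReflTransGen.head_induction_on with
  | refl => exact ⟨U, rfl⟩
  | head h _ ih =>
    obtain ⟨T, rfl⟩ := ih
    exact exists_word_eq_of_wordRaise_word h.choose_spec

theorem reflTransGen_raisingStep_iff :
    Relation.ReflTransGen (RaisingStep χ.semitic) T U ↔
      WordRaises (T.word χ.semitic) (U.word χ.semitic) := by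
  refine ⟨fun h => Relation.ReflTransGen.lift (fun T : SkewTableau χ => T.word χ.semitic)
    (fun _ _ h => h) _ _ h, fun h => ?_⟩
  generalize hw : U.word χ.semitic = w at h
  induction h generalizing U with
  | refl => exact word_injective hw ▸ .refl
  | tail h₁ h₂ ih =>
    subst hw
    obtain ⟨V, rfl⟩ := exists_word_eq_of_wordRaises h₁
    exact (ih rfl).tail h₂

theorem isNormalFormOf_raisingStep_iff : IsNormalFormOf (RaisingStep r) T U ↔
    WordRaises (T.word χ.semitic) (U.word χ.semitic) ∧ U.IsDominant := by
  have hr : RaisingStep r = RaisingStep χ.semitic :=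
    funext₂ fun _ _ => propext (raisingStep_iff_raisingStep _ _)
  rw [hr, IsNormalFormOf, reflTransGen_raisingStep_iff]
  refine and_congr_right fun _ => ⟨fun h i => ?_, fun h V ⟨i, hV⟩ =>
    wordDominantFor_iff_forall_not_wordRaise.1 (h i) _ hV⟩
  refine wordDominantFor_iff_forall_not_wordRaise.2 fun w hw => ?_
  obtain ⟨V, rfl⟩ := exists_word_eq_of_wordRaise hw
  exact h V ⟨i, hw⟩

theorem exists_wordRaises_and_isDominant (T : SkewTableau χ) :
    ∃ L : SkewTableau χ, WordRaises (T.word χ.semitic) (L.word χ.semitic) ∧ L.IsDominant := by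
  obtain ⟨w, hw, hdom⟩ := exists_wordRaises_and_forall_wordDominantFor (T.word χ.semitic)
  obtain ⟨L, rfl⟩ := exists_word_eq_of_wordRaises hw
  exact ⟨L, hw, hdom⟩

end SkewTableau

namespace SkewTableau

section Weight

variable {χ χ' : SkewShape} {T : SkewTableau χ} {T' : SkewTableau χ'} {r : ReadingOrder χ}
  {r' : ReadingOrder χ'}

theorem weight_eq_count (T : SkewTableau χ) (r : ReadingOrder χ) (i : ℕ) :
    T.weight i = (T.word r).count i := by
  have hcells : χ.cells.val = r.squares := by
    rw [Multiset.Nodup.ext χ.cells.nodup (Multiset.coe_nodup.2 r.nodup)]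
    exact fun c => (r.mem_squares c).symm
  rw [weight, word, Finset.card_def, Finset.filter_val, hcells, Multiset.filter_coe,
    Multiset.coe_card, List.count_eq_countP, List.countP_map, List.countP_eq_length_filter]
  rfl

theorem weight_eq_weight_of_perm (h : (T.word r).Perm (T'.word r')) : T.weight = T'.weight := by
  ext i
  rw [weight_eq_count T r, weight_eq_count T' r', h.count_eq]

theorem mem_word_iff {a : ℕ} : a ∈ T.word r ↔ ∃ c ∈ χ.cells, T.entry c = a := by
  simp only [word, List.mem_map, r.mem_squares]

end Weight

section Straight

variable {ν ν' : YoungDiagram} {Q Q₁ : SkewTableau (.ofPartition ν)}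
  {Q' : SkewTableau (.ofPartition ν')} {x c : ℕ × ℕ}

theorem mem_cells_ofPartition : c ∈ (SkewShape.ofPartition ν).cells ↔ c ∈ ν := by
  simp [SkewShape.cells, SkewShape.ofPartition]

theorem entry_eq_fst_of_forall_mem {u v : List (ℕ × ℕ)}
    (hQ : Q.IsDominant)
    (h : (SkewShape.ofPartition ν).semitic.squares = u ++ x :: v)
    (hu : ∀ c ∈ u, Q.entry c = c.1) : Q.entry x = x.1 := by
  have mem_cells {c} (hc : c ∈ u ++ x :: v) : c ∈ (SkewShape.ofPartition ν).cells :=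
    (ReadingOrder.mem_squares _ c).1 (h ▸ hc)
  have hx := mem_cells (c := x) (by simp)
  have fst_le : x.1 ≤ Q.entry x := by
    have := Q.entry_add_le (c := (0, x.2)) (d := x) (mem_cells_ofPartition.2
      (ν.up_left_mem x.1.zero_le le_rfl (mem_cells_ofPartition.1 hx))) hx ⟨x.1.zero_le, le_rfl⟩
    omega
  by_contra hne
  obtain ⟨k, hk⟩ : ∃ k, Q.entry x = k + 1 := Nat.exists_eq_succ_of_ne_zero (by omega)
  have hcount := hQ k ((u ++ [x]).map Q.entry) ⟨v.map Q.entry, by simp [word, h]⟩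
  have hkmem : k ∈ (u ++ [x]).map Q.entry := List.count_pos_iff.1
    ((List.count_pos_iff.2 (by simp [hk])).trans_le hcount)
  obtain ⟨z, hz, hzk⟩ : ∃ z ∈ u, Q.entry z = k := by simpa [hk] using hkmem
  have hzx := (List.pairwise_append.1 (h ▸ SkewShape.pairwise_semitic _)).2.2 z hz x
    List.mem_cons_self
  have := hu z hz
  have := Q.entry_add_le hx (mem_cells (List.mem_append_left _ hz)) ⟨by omega, by omega⟩
  omega

theorem entry_eq_fst_of_isDominant (hQ : Q.IsDominant)
    (hc : c ∈ (SkewShape.ofPartition ν).cells) : Q.entry c = c.1 := by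
  have forall_mem {u v} (h : (SkewShape.ofPartition ν).semitic.squares = u ++ v) :
      ∀ c ∈ u, Q.entry c = c.1 := by
    induction u using List.reverseRecOn generalizing v with
    | nil => exact fun c hc => absurd hc List.not_mem_nil
    | append_singleton u x ih =>
      rw [List.append_assoc] at h
      have hx := entry_eq_fst_of_forall_mem hQ h (ih h)
      intro c hc
      rcases List.mem_append.1 hc with hc | hc
      · exact ih h c hc
      · rwa [List.mem_singleton.1 hc]
  exact forall_mem (List.append_nil _).symm c ((ReadingOrder.mem_squares _ c).2 hc)

theorem eq_of_isDominant (hQ : Q.IsDominant) (hQ₁ : Q₁.IsDominant) : Q = Q₁ := by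
  ext c
  by_cases hc : c ∈ (SkewShape.ofPartition ν).cells
  · rw [entry_eq_fst_of_isDominant hQ hc, entry_eq_fst_of_isDominant hQ₁ hc]
  · rw [Q.zeros c hc, Q₁.zeros c hc]

theorem weight_eq_rowLen_of_isDominant (hQ : Q.IsDominant) : Q.weight = ν.rowLen := by
  ext i
  rw [ν.rowLen_eq_card, weight]
  congr 1
  ext c
  rw [Finset.mem_filter, YoungDiagram.mem_row_iff, mem_cells_ofPartition]
  refine and_congr_right fun hc => ?_
  rw [entry_eq_fst_of_isDominant hQ (mem_cells_ofPartition.2 hc)]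

end Straight

end SkewTableau

theorem rowLen_injective : Function.Injective YoungDiagram.rowLen := by
  intro ν ν' h
  ext c
  rw [YoungDiagram.mem_cells, YoungDiagram.mem_cells, YoungDiagram.mem_iff_lt_rowLen, h,
    YoungDiagram.mem_iff_lt_rowLen]

namespace SkewTableau

/-- Some coplactic automorphism turns the word of `T` into that of `U`. By `KnuthEquiv` this holds
if `T` and `U` are related by jeu de taquin. -/
def PlacticEquiv {χ χ' : SkewShape} (T : SkewTableau χ) (U : SkewTableau χ') : Prop :=
  ∃ φ ∈ coplacticAut, φ (T.word χ.semitic) = U.word χ'.semitic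

variable {χ χ' χ'' : SkewShape} {T T' L L' : SkewTableau χ} {U : SkewTableau χ'}
  {V : SkewTableau χ''} {ν ν' : YoungDiagram} {P : SkewTableau (.ofPartition ν)}
  {P' : SkewTableau (.ofPartition ν')} {φ : Equiv.Perm (List ℕ)}

theorem PlacticEquiv.refl (T : SkewTableau χ) : T.PlacticEquiv T := ⟨1, one_mem _, rfl⟩

theorem PlacticEquiv.symm (h : T.PlacticEquiv U) : U.PlacticEquiv T := by
  obtain ⟨φ, hφ, h⟩ := h
  exact ⟨φ⁻¹, inv_mem hφ, by simp [← h]⟩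

theorem PlacticEquiv.trans (h : T.PlacticEquiv U) (h' : U.PlacticEquiv V) : T.PlacticEquiv V := by
  obtain ⟨φ, hφ, h⟩ := h
  obtain ⟨φ', hφ', h'⟩ := h'
  exact ⟨φ' * φ, mul_mem hφ' hφ, by rw [Equiv.Perm.mul_apply, h, h']⟩

theorem PlacticEquiv.perm (h : T.PlacticEquiv U) :
    (T.word χ.semitic).Perm (U.word χ'.semitic) := by
  obtain ⟨φ, hφ, h⟩ := h
  exact h ▸ (hφ.2 _).symm

theorem exists_word_eq_apply (hφ : φ ∈ coplacticAut)
    (hTU : φ (T.word χ.semitic) = U.word χ'.semitic)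
    (hTL : WordRaises (T.word χ.semitic) (L.word χ.semitic)) (hL : L.IsDominant) :
    ∃ M : SkewTableau χ', M.word χ'.semitic = φ (L.word χ.semitic) ∧
      WordRaises (U.word χ'.semitic) (M.word χ'.semitic) ∧ M.IsDominant := by
  rw [← wordRaises_apply_iff_of_mem_coplacticAut hφ, hTU] at hTL
  obtain ⟨M, hM⟩ := exists_word_eq_of_wordRaises hTL
  refine ⟨M, hM, hM ▸ hTL, fun i => ?_⟩
  exact hM ▸ (wordDominantFor_apply_iff_of_mem_coplacticAut hφ i).2 (hL i)

theorem eq_of_placticEquiv (h : P.PlacticEquiv P') :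
    (⟨ν, P⟩ : Σ ν, SkewTableau (.ofPartition ν)) = ⟨ν', P'⟩ := by
  obtain ⟨φ, hφ, h⟩ := h
  obtain ⟨Q, hPQ, hQ⟩ := P.exists_wordRaises_and_isDominant
  obtain ⟨Q', hQQ', -, hQ'⟩ := exists_word_eq_apply hφ h hPQ hQ
  have hweight : Q'.weight = Q.weight := weight_eq_weight_of_perm (hQQ' ▸ hφ.2 _)
  rw [weight_eq_rowLen_of_isDominant hQ, weight_eq_rowLen_of_isDominant hQ'] at hweight
  obtain rfl := rowLen_injective hweight
  obtain rfl := eq_of_isDominant hQ hQ'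
  rw [apply_eq_self_of_wordRaises hφ hPQ hQQ'.symm] at h
  rw [word_injective h]

theorem PlacticEquiv.weight_eq_rowLen (h : T.PlacticEquiv P)
    (hTL : WordRaises (T.word χ.semitic) (L.word χ.semitic)) (hL : L.IsDominant) :
    L.weight = ν.rowLen := by
  obtain ⟨φ, hφ, h⟩ := h
  obtain ⟨Q, hLQ, -, hQ⟩ := exists_word_eq_apply hφ h hTL hL
  rw [← weight_eq_rowLen_of_isDominant hQ]
  exact weight_eq_weight_of_perm (hLQ ▸ (hφ.2 _).symm)

theorem PlacticEquiv.dominant_unique (h : T.PlacticEquiv P)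
    (hTL : WordRaises (T.word χ.semitic) (L.word χ.semitic)) (hL : L.IsDominant)
    (hTL' : WordRaises (T.word χ.semitic) (L'.word χ.semitic)) (hL' : L'.IsDominant) : L = L' := by
  obtain ⟨φ, hφ, h⟩ := h
  obtain ⟨Q, hLQ, -, hQ⟩ := exists_word_eq_apply hφ h hTL hL
  obtain ⟨Q', hLQ', -, hQ'⟩ := exists_word_eq_apply hφ h hTL' hL'
  obtain rfl := eq_of_isDominant hQ hQ'
  exact word_injective (φ.injective (hLQ.symm.trans hLQ'))

theorem eq_of_placticEquiv_of_wordRaises (h : T.PlacticEquiv P) (h' : T'.PlacticEquiv P)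
    (hTL : WordRaises (T.word χ.semitic) (L.word χ.semitic))
    (hTL' : WordRaises (T'.word χ.semitic) (L.word χ.semitic)) (hL : L.IsDominant) : T = T' := by
  obtain ⟨φ, hφ, hTT'⟩ := h.trans h'.symm
  obtain ⟨L', hLL', hTL'', hL'⟩ := exists_word_eq_apply hφ hTT' hTL hL
  obtain rfl := h'.dominant_unique hTL' hL hTL'' hL'
  rw [apply_eq_self_of_wordRaises hφ hTL hLL'.symm] at hTT'
  exact word_injective hTT'

end SkewTableau

/-- The squares of row `i` in the columns `j` with `a ≤ j < b`, from right to left. -/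
def rowSquares (i a b : ℕ) : List (ℕ × ℕ) := (List.Ico a b).reverse.map fun j => (i, j)

section RowSquares

variable {i j a b k : ℕ} {c : ℕ × ℕ}

theorem mem_rowSquares : c ∈ rowSquares i a b ↔ c.1 = i ∧ a ≤ c.2 ∧ c.2 < b := by
  obtain ⟨i', j⟩ := c
  simp only [rowSquares, List.mem_map, List.mem_reverse, List.Ico.mem, Prod.mk.injEq]
  grind

theorem rowSquares_append (hab : a ≤ b) (hbk : b ≤ k) :
    rowSquares i b k ++ rowSquares i a b = rowSquares i a k := by
  rw [rowSquares, rowSquares, rowSquares, ← List.map_append, ← List.reverse_append,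
    List.Ico.append_consecutive hab hbk]

theorem rowSquares_self_succ : rowSquares i j (j + 1) = [(i, j)] := by
  simp [rowSquares]

theorem rowSquares_append_cons (haj : a ≤ j) (hjb : j < b) :
    rowSquares i (j + 1) b ++ (i, j) :: rowSquares i a j = rowSquares i a b := by
  rw [← rowSquares_append (haj.trans j.le_succ) hjb, ← rowSquares_append haj j.le_succ,
    rowSquares_self_succ]
  rfl

theorem revRow_eq_rowSquares (χ : SkewShape) (i : ℕ) :
    χ.revRow i = rowSquares i (χ.inner.rowLen i) (χ.outer.rowLen i) := by
  rw [SkewShape.revRow, rowSquares, ← List.Ico.zero_bot, List.Ico.filter_le,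
    max_eq_right (Nat.zero_le _)]

end RowSquares

theorem exists_semitic_squares_eq_append (χ : SkewShape) {i j : ℕ} (hij : (i, j) ∈ χ.cells)
    (hij' : (i + 1, j) ∈ χ.cells) : ∃ u v a b, a ≤ j ∧ j < b ∧
      (∀ k, a ≤ k → k < b → (i, k) ∈ χ.cells ∧ (i + 1, k) ∈ χ.cells) ∧ χ.semitic.squares =
        u ++ (rowSquares i (j + 1) b ++ (i, j) :: rowSquares i a j ++
          (rowSquares (i + 1) (j + 1) b ++ (i + 1, j) :: rowSquares (i + 1) a j)) ++ v := by
  simp only [SkewShape.cells, Finset.mem_sdiff, YoungDiagram.mem_cells,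
    YoungDiagram.mem_iff_lt_rowLen, not_lt] at hij hij' ⊢
  have hn : i + 2 ≤ χ.outer.colLen 0 := YoungDiagram.mem_iff_lt_colLen.1
    (χ.outer.up_left_mem le_rfl j.zero_le (YoungDiagram.mem_iff_lt_rowLen.2 hij'.1))
  have upper := χ.outer.rowLen_anti i (i + 1) i.le_succ
  have lower := χ.inner.rowLen_anti i (i + 1) i.le_succ
  refine ⟨(List.range i).flatMap χ.revRow ++
      rowSquares i (χ.outer.rowLen (i + 1)) (χ.outer.rowLen i),
    rowSquares (i + 1) (χ.inner.rowLen (i + 1)) (χ.inner.rowLen i) ++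
      (List.Ico (i + 2) (χ.outer.colLen 0)).flatMap χ.revRow, χ.inner.rowLen i,
    χ.outer.rowLen (i + 1), hij.2, hij'.1, fun k hk hk' => by omega, ?_⟩
  rw [rowSquares_append_cons hij.2 hij'.1, rowSquares_append_cons hij.2 hij'.1]
  have rows : List.range (χ.outer.colLen 0) =
      List.range i ++ i :: (i + 1) :: List.Ico (i + 2) (χ.outer.colLen 0) := by
    rw [← List.Ico.zero_bot, ← List.Ico.zero_bot,
      ← List.Ico.append_consecutive i.zero_le (show i ≤ χ.outer.colLen 0 by omega),
      List.Ico.eq_cons (show i < χ.outer.colLen 0 by omega),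
      List.Ico.eq_cons (show i + 1 < χ.outer.colLen 0 by omega)]
  simp only [SkewShape.semitic, rows, List.flatMap_append, List.flatMap_cons, revRow_eq_rowSquares]
  rw [← rowSquares_append (i := i) (hij.2.trans hij'.1.le) upper,
    ← rowSquares_append lower (hij.2.trans hij'.1.le)]
  simp only [List.append_assoc]

/-- A filling of the squares of `χ` other than the empty square `h` that satisfies the conditions of
a semistandard tableau; these are the states of an inward slide in which `χ.inner` is the new inner
shape and `χ.outer` the old outer shape. The value of `f` is `0` at `h` and outside `χ`. -/
structure IsPunctured (χ : SkewShape) (h : ℕ × ℕ) (f : ℕ × ℕ → ℕ) : Prop where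
  mem : h ∈ χ.cells
  row_weak : ∀ ⦃i j j'⦄, j < j' → (i, j) ∈ χ.cells → (i, j') ∈ χ.cells → (i, j) ≠ h →
    (i, j') ≠ h → f (i, j) ≤ f (i, j')
  col_strict : ∀ ⦃i i' j⦄, i < i' → (i, j) ∈ χ.cells → (i', j) ∈ χ.cells → (i, j) ≠ h →
    (i', j) ≠ h → f (i, j) < f (i', j)
  zeros : ∀ ⦃c⦄, c ∉ χ.cells ∨ c = h → f c = 0

/-- The letters of the squares of `χ` other than `h`, in the Semitic reading order. -/
def puncturedWord (χ : SkewShape) (h : ℕ × ℕ) (f : ℕ × ℕ → ℕ) : List ℕ :=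
  (χ.semitic.squares.erase h).map f

section SlideMove

variable {χ : SkewShape} {i j : ℕ} {h h' : ℕ × ℕ} {f f' : ℕ × ℕ → ℕ}

theorem puncturedWord_eq {u v : List (ℕ × ℕ)} (hχ : χ.semitic.squares = u ++ h :: v) :
    puncturedWord χ h f = u.map f ++ v.map f := by
  rw [puncturedWord, hχ, List.erase_append_right _
    fun hu => ReadingOrder.disjoint hχ hu List.mem_cons_self, List.erase_cons_head, List.map_append]

theorem mem_cells_of_mem_outer {c d : ℕ × ℕ} (hc : c ∈ χ.cells) (hd : d ∈ χ.outer) (hcd : c ≤ d) :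
    d ∈ χ.cells := by
  rw [SkewShape.cells, Finset.mem_sdiff] at hc ⊢
  exact ⟨hd, fun hd' => hc.2 (χ.inner.up_left_mem hcd.1 hcd.2 hd')⟩

theorem IsPunctured.move (hf : IsPunctured χ h f) (hmem : h' ∈ χ.cells)
    (left : ∀ j < h.2, (h.1, j) ∈ χ.cells → (h.1, j) ≠ h' → f (h.1, j) ≤ f h')
    (right : ∀ j > h.2, (h.1, j) ∈ χ.cells → (h.1, j) ≠ h' → f h' ≤ f (h.1, j))
    (above : ∀ i < h.1, (i, h.2) ∈ χ.cells → (i, h.2) ≠ h' → f (i, h.2) < f h')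
    (below : ∀ i > h.1, (i, h.2) ∈ χ.cells → (i, h.2) ≠ h' → f h' < f (i, h.2)) :
    IsPunctured χ h' (Function.update (Function.update f h (f h')) h' 0) where
  mem := hmem
  row_weak i j j' hj hc hd hch hdh := by
    have := hf.row_weak hj hc hd
    grind
  col_strict i i' j hi hc hd hch hdh := by
    have := hf.col_strict hi hc hd
    grind
  zeros c hc := by
    have := hf.zeros (c := c)
    have := hf.mem
    grind

theorem IsPunctured.up (hf : IsPunctured χ (i, j) f) (hmem : (i + 1, j) ∈ χ.outer)
    (hle : (i, j + 1) ∈ χ.outer → f (i + 1, j) ≤ f (i, j + 1)) :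
    IsPunctured χ (i + 1, j)
      (Function.update (Function.update f (i, j) (f (i + 1, j))) (i + 1, j) 0) := by
  have hmem' := mem_cells_of_mem_outer hf.mem hmem ⟨i.le_succ, le_rfl⟩
  refine hf.move hmem' (fun b hb hc _ => ?_) (fun b hb hc _ => ?_) (fun a ha hc _ => ?_)
    (fun a ha hc _ => ?_)
  · dsimp only at hb hc ⊢
    have hc' : (i + 1, b) ∈ χ.cells :=
      SkewShape.mem_cells_of_le_of_le hc hmem' ⟨i.le_succ, le_rfl⟩ ⟨le_rfl, hb.le⟩
    have := hf.col_strict i.lt_add_one hc hc' (by grind) (by grind)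
    have := hf.row_weak hb hc' hmem' (by grind) (by grind)
    omega
  · dsimp only at hb hc ⊢
    have hc' : (i, j + 1) ∈ χ.cells :=
      SkewShape.mem_cells_of_le_of_le hf.mem hc ⟨le_rfl, j.le_succ⟩ ⟨le_rfl, hb⟩
    have hle' := hle (Finset.mem_sdiff.1 hc').1
    rcases (Nat.succ_le_of_lt hb).eq_or_lt with rfl | hb'
    · exact hle'
    · exact hle'.trans (hf.row_weak hb' hc' hc (by grind) (by grind))
  · exact hf.col_strict (by grind) hc hmem' (by grind) (by grind)
  · exact hf.col_strict (by grind) hmem' hc (by grind) (by grind)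

theorem IsPunctured.left (hf : IsPunctured χ (i, j) f) (hmem : (i, j + 1) ∈ χ.outer)
    (hlt : (i + 1, j) ∈ χ.outer → f (i, j + 1) < f (i + 1, j)) :
    IsPunctured χ (i, j + 1)
      (Function.update (Function.update f (i, j) (f (i, j + 1))) (i, j + 1) 0) := by
  have hmem' := mem_cells_of_mem_outer hf.mem hmem ⟨le_rfl, j.le_succ⟩
  refine hf.move hmem' (fun b hb hc _ => ?_) (fun b hb hc _ => ?_) (fun a ha hc _ => ?_)
    (fun a ha hc _ => ?_)
  · exact hf.row_weak (by grind) hc hmem' (by grind) (by grind)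
  · exact hf.row_weak (by grind) hmem' hc (by grind) (by grind)
  · dsimp only at ha hc ⊢
    have hc' : (a, j + 1) ∈ χ.cells :=
      SkewShape.mem_cells_of_le_of_le hc hmem' ⟨le_rfl, j.le_succ⟩ ⟨ha.le, le_rfl⟩
    have := hf.row_weak j.lt_add_one hc hc' (by grind) (by grind)
    have := hf.col_strict ha hc' hmem' (by grind) (by grind)
    omega
  · dsimp only at ha hc ⊢
    have hc' : (i + 1, j) ∈ χ.cells :=
      SkewShape.mem_cells_of_le_of_le hf.mem hc ⟨i.le_succ, le_rfl⟩ ⟨ha, le_rfl⟩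
    have hlt' := hlt (Finset.mem_sdiff.1 hc').1
    rcases (Nat.succ_le_of_lt ha).eq_or_lt with rfl | ha'
    · exact hlt'
    · exact hlt'.trans (hf.col_strict ha' hc' hc (by grind) (by grind))

theorem IsPunctured.pairwise_map_rowSquares {a b : ℕ} (hf : IsPunctured χ h f)
    (hmem : ∀ c ∈ rowSquares i a b, c ∈ χ.cells ∧ c ≠ h) :
    ((rowSquares i a b).map f).Pairwise (· ≥ ·) := by
  have sorted : (rowSquares i a b).Pairwise fun c d => c.1 = d.1 ∧ d.2 < c.2 := by
    simp only [rowSquares, List.pairwise_map, List.pairwise_reverse, true_and]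
    exact List.Ico.pairwise_lt a b
  refine List.pairwise_map.2 (sorted.imp_of_mem fun {c d} hc hd hcd => ?_)
  obtain ⟨⟨a, b⟩, ⟨_, b'⟩⟩ := c, d
  obtain ⟨rfl, hb⟩ := hcd
  exact hf.row_weak hb (hmem _ hd).1 (hmem _ hc).1 (hmem _ hd).2 (hmem _ hc).2

theorem IsPunctured.forall₂_map_rowSquares {a b : ℕ} (hf : IsPunctured χ h f)
    (hmem : ∀ c ∈ rowSquares i a b, c ∈ χ.cells ∧ c ≠ h)
    (hmem' : ∀ c ∈ rowSquares (i + 1) a b, c ∈ χ.cells ∧ c ≠ h) :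
    ((rowSquares i a b).map f).Forall₂ (· < ·) ((rowSquares (i + 1) a b).map f) := by
  simp only [mem_rowSquares, Prod.forall] at hmem hmem'
  simp only [rowSquares, List.map_map, List.forall₂_map_left_iff, List.forall₂_map_right_iff,
    List.forall₂_same, List.mem_reverse, List.Ico.mem, Function.comp_apply]
  intro k hk
  obtain ⟨hc, hch⟩ := hmem i k ⟨rfl, hk⟩
  obtain ⟨hd, hdh⟩ := hmem' (i + 1) k ⟨rfl, hk⟩
  exact hf.col_strict i.lt_add_one hc hd hch hdh

theorem map_update_update_eq_of_notMem {l : List (ℕ × ℕ)} {k k' : ℕ} (hl : h ∉ l) (hl' : h' ∉ l) :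
    l.map (Function.update (Function.update f h k) h' k') = l.map f :=
  List.map_inj_left.2 fun c hc => by
    rw [Function.update_of_ne (ne_of_mem_of_not_mem hc hl'),
      Function.update_of_ne (ne_of_mem_of_not_mem hc hl)]

theorem puncturedWord_left (hmem : (i, j) ∈ χ.cells) (hmem' : (i, j + 1) ∈ χ.cells) :
    puncturedWord χ (i, j + 1)
      (Function.update (Function.update f (i, j) (f (i, j + 1))) (i, j + 1) 0) =
      puncturedWord χ (i, j) f := by
  obtain ⟨u, m, v, hχ, hm⟩ :=
    ReadingOrder.exists_semitic_squares_eq hmem hmem' rfl j.lt_add_one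
  obtain rfl : m = [] := List.eq_nil_iff_forall_not_mem.2 fun z hz => by grind
  have nodup := hχ ▸ χ.semitic.nodup
  simp only [List.append_assoc, List.cons_append, List.nil_append, List.nodup_append,
    List.nodup_cons, List.mem_cons, not_or] at nodup
  obtain ⟨-, ⟨⟨-, hv'⟩, hv, -⟩, hu⟩ := nodup
  rw [puncturedWord_eq (u := u ++ [(i, j + 1)]) (v := v) hχ,
    puncturedWord_eq (u := u) (v := (i, j) :: v) (by simpa using hχ), List.map_cons,
    map_update_update_eq_of_notMem hv hv',
    map_update_update_eq_of_notMem (fun h => hu _ h _ (.inr (.inl rfl)) rfl)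
      fun h => hu _ h _ (.inl rfl) rfl]
  simp

theorem puncturedWord_update {u m v : List (ℕ × ℕ)}
    (hχ : χ.semitic.squares = u ++ h :: m ++ h' :: v) :
    puncturedWord χ h' (Function.update (Function.update f h (f h')) h' 0) =
      u.map f ++ f h' :: m.map f ++ v.map f := by
  have nodup := hχ ▸ χ.semitic.nodup
  obtain ⟨hh', nodup'⟩ := List.nodup_cons.1 (List.nodup_middle.1 nodup)
  have hh := nodup'
  rw [List.append_assoc, List.cons_append, List.nodup_middle, List.nodup_cons] at hh
  simp only [List.mem_append, List.mem_cons, not_or] at hh' hh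
  rw [puncturedWord_eq hχ, List.map_append, List.map_cons,
    map_update_update_eq_of_notMem hh.1.1 hh'.1.1,
    map_update_update_eq_of_notMem hh.1.2.1 hh'.1.2.2,
    map_update_update_eq_of_notMem hh.1.2.2 hh'.2,
    Function.update_of_ne (Ne.symm hh'.1.2.1), Function.update_self]

theorem IsPunctured.knuthEquiv_up (hf : IsPunctured χ (i, j) f)
    (hf' : IsPunctured χ (i + 1, j)
      (Function.update (Function.update f (i, j) (f (i + 1, j))) (i + 1, j) 0)) :
    KnuthEquiv (puncturedWord χ (i, j) f) (puncturedWord χ (i + 1, j)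
      (Function.update (Function.update f (i, j) (f (i + 1, j))) (i + 1, j) 0)) := by
  obtain ⟨u, v, a, b, ha, hb, hcells, hχ⟩ := exists_semitic_squares_eq_append χ hf.mem hf'.mem
  rw [puncturedWord_eq (u := u ++ rowSquares i (j + 1) b) (v := rowSquares i a j ++
      (rowSquares (i + 1) (j + 1) b ++ (i + 1, j) :: rowSquares (i + 1) a j) ++ v) (by simp [hχ]),
    puncturedWord_update (u := u ++ rowSquares i (j + 1) b) (v := rowSquares (i + 1) a j ++ v)
      (m := rowSquares i a j ++ rowSquares (i + 1) (j + 1) b) (by simp [hχ])]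
  have row_eq : (rowSquares i a b).map
      (Function.update (Function.update f (i, j) (f (i + 1, j))) (i + 1, j) 0) =
      (rowSquares i (j + 1) b).map f ++ f (i + 1, j) :: (rowSquares i a j).map f := by
    rw [← rowSquares_append_cons ha hb, List.map_append, List.map_cons,
      map_update_update_eq_of_notMem, map_update_update_eq_of_notMem] <;> simp [mem_rowSquares]
  have row_eq' : (rowSquares (i + 1) a (j + 1)).map f =
      f (i + 1, j) :: (rowSquares (i + 1) a j).map f := by
    rw [← rowSquares_append_cons ha j.lt_add_one]
    simp [rowSquares]
  have move := KnuthEquiv.move_up (y := f (i + 1, j))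
    (hf.forall₂_map_rowSquares (i := i) (a := j + 1) (b := b) ?_ ?_)
    (hf.forall₂_map_rowSquares (i := i) (a := a) (b := j) ?_ ?_)
    (row_eq ▸ hf'.pairwise_map_rowSquares ?_) (row_eq' ▸ hf.pairwise_map_rowSquares ?_)
  · simpa using move.append_append (u.map f) (v.map f)
  all_goals
    rintro ⟨i', k⟩ hk
    obtain ⟨rfl, hk⟩ := mem_rowSquares.1 hk
    have := hcells k
    grind

theorem IsPunctured.slideMove {s s' : (ℕ × ℕ) × (ℕ × ℕ → ℕ)} (hs : IsPunctured χ s.1 s.2)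
    (hss' : SlideMove χ.outer s s') :
    IsPunctured χ s'.1 s'.2 ∧
      KnuthEquiv (puncturedWord χ s.1 s.2) (puncturedWord χ s'.1 s'.2) := by
  cases hss' with
  | up i j f hmem hle =>
    have hf' := hs.up hmem hle
    exact ⟨hf', hs.knuthEquiv_up hf'⟩
  | left i j f hmem hlt =>
    have hf' := hs.left hmem hlt
    exact ⟨hf', puncturedWord_left (f := f) hs.mem hf'.mem ▸ .refl _⟩

theorem IsPunctured.reflTransGen_slideMove {s s' : (ℕ × ℕ) × (ℕ × ℕ → ℕ)}
    (hs : IsPunctured χ s.1 s.2) (hss' : Relation.ReflTransGen (SlideMove χ.outer) s s') :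
    IsPunctured χ s'.1 s'.2 ∧
      KnuthEquiv (puncturedWord χ s.1 s.2) (puncturedWord χ s'.1 s'.2) := by
  induction hss' with
  | refl => exact ⟨hs, .refl _⟩
  | tail _ hst ih =>
    obtain ⟨ht, h⟩ := ih.1.slideMove hst
    exact ⟨ht, ih.2.trans h⟩

end SlideMove

theorem exists_isNormalFormOf_slideMove (lam : YoungDiagram) (s : (ℕ × ℕ) × (ℕ × ℕ → ℕ)) :
    ∃ t, IsNormalFormOf (SlideMove lam) s t := by
  refine exists_isNormalFormOf_of_measure
    (fun s => {c ∈ lam.cells | s.1.1 + s.1.2 < c.1 + c.2}.card) (fun s t hst => ?_) s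
  have hst' : t.1 ∈ lam ∧ s.1.1 + s.1.2 < t.1.1 + t.1.2 := by
    cases hst with
    | up i j f hmem => exact ⟨hmem, by grind⟩
    | left i j f hmem => exact ⟨hmem, by grind⟩
  refine Finset.card_lt_card ((Finset.ssubset_iff_of_subset fun c hc => ?_).2 ⟨t.1, ?_, ?_⟩)
  · simp only [Finset.mem_filter] at hc ⊢
    exact ⟨hc.1, hst'.2.trans hc.2⟩
  · simpa using hst'
  · simp

theorem notMem_of_forall_not_slideMove {lam : YoungDiagram} {h : ℕ × ℕ} {f : ℕ × ℕ → ℕ}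
    (stuck : ∀ s, ¬ SlideMove lam (h, f) s) : (h.1 + 1, h.2) ∉ lam ∧ (h.1, h.2 + 1) ∉ lam := by
  have below (hmem : (h.1 + 1, h.2) ∈ lam) : (h.1, h.2 + 1) ∈ lam ∧
      f (h.1, h.2 + 1) < f (h.1 + 1, h.2) := by
    by_contra hle
    exact stuck _ (.up h.1 h.2 f hmem fun hmem' => not_lt.1 fun hlt => hle ⟨hmem', hlt⟩)
  have right : (h.1, h.2 + 1) ∉ lam := fun hmem =>
    stuck _ (.left h.1 h.2 f hmem fun hmem' => (below hmem').2)
  exact ⟨fun hmem => right (below hmem).1, right⟩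

theorem exists_cells_eq_erase {ν : YoungDiagram} {c : ℕ × ℕ} (below : (c.1 + 1, c.2) ∉ ν)
    (right : (c.1, c.2 + 1) ∉ ν) : ∃ ν' : YoungDiagram, ν'.cells = ν.cells.erase c := by
  refine ⟨⟨ν.cells.erase c, fun d e hed hd => ?_⟩, rfl⟩
  simp only [Finset.mem_coe, Finset.mem_erase, YoungDiagram.mem_cells] at hd ⊢
  refine ⟨?_, ν.up_left_mem hed.1 hed.2 hd.2⟩
  rintro rfl
  rcases hed.1.lt_or_eq with h | h
  · exact below (ν.up_left_mem h hed.2 hd.2)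
  · have : e.2 < d.2 := hed.2.lt_of_ne fun h' => hd.1 (Prod.ext h.symm h'.symm)
    exact right (ν.up_left_mem hed.1 this hd.2)

section PuncturedShape

variable {χ ψ : SkewShape} {h : ℕ × ℕ} {f : ℕ × ℕ → ℕ}

theorem semitic_squares_eq_erase (hχψ : χ.cells = ψ.cells.erase h) :
    χ.semitic.squares = ψ.semitic.squares.erase h := by
  have perm : χ.semitic.squares.Perm (ψ.semitic.squares.erase h) :=
    (List.perm_ext_iff_of_nodup χ.semitic.nodup (ψ.semitic.nodup.erase h)).2 fun c => by
      rw [ψ.semitic.nodup.mem_erase_iff, ReadingOrder.mem_squares, ReadingOrder.mem_squares, hχψ,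
        Finset.mem_erase]
  refine perm.eq_of_pairwise (fun c d _ _ hcd hdc => ?_) χ.pairwise_semitic
    (ψ.pairwise_semitic.sublist List.erase_sublist)
  omega

theorem SkewTableau.word_eq_puncturedWord (T : SkewTableau χ) (hχψ : χ.cells = ψ.cells.erase h) :
    T.word χ.semitic = puncturedWord ψ h T.entry := by
  rw [SkewTableau.word, puncturedWord, semitic_squares_eq_erase hχψ]

theorem SkewTableau.isPunctured (T : SkewTableau χ) (hψ : h ∈ ψ.cells)
    (hχψ : χ.cells = ψ.cells.erase h) : IsPunctured ψ h T.entry where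
  mem := hψ
  row_weak i j j' hj hc hd hch hdh := T.row_weak i j j' hj (by simp [*]) (by simp [*])
  col_strict i i' j hi hc hd hch hdh := T.col_strict i i' j hi (by simp [*]) (by simp [*])
  zeros c hc := T.zeros c (by grind)

theorem cells_eq_erase_of_inner (houter : ψ.outer = χ.outer)
    (hinner : ψ.inner.cells = χ.inner.cells.erase h) (hχ : h ∈ χ.inner) :
    h ∈ ψ.cells ∧ χ.cells = ψ.cells.erase h := by
  have hχ' : h ∈ χ.outer.cells := χ.inner_le hχ
  rw [← YoungDiagram.mem_cells] at hχ
  simp only [SkewShape.cells, houter, hinner, Finset.ext_iff]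
  grind

theorem IsPunctured.exists_entry_eq (hf : IsPunctured ψ h f) (hχψ : χ.cells = ψ.cells.erase h) :
    ∃ T : SkewTableau χ, T.entry = f := by
  have mem_cells (c) (hc : c ∈ χ.cells) : c ∈ ψ.cells ∧ c ≠ h := by grind
  exact ⟨{
    entry := f
    row_weak i j j' hj hc hd := hf.row_weak hj (mem_cells _ hc).1 (mem_cells _ hd).1
      (mem_cells _ hc).2 (mem_cells _ hd).2
    col_strict i i' j hi hc hd := hf.col_strict hi (mem_cells _ hc).1 (mem_cells _ hd).1
      (mem_cells _ hc).2 (mem_cells _ hd).2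
    zeros c hc := hf.zeros (by grind) }, rfl⟩

end PuncturedShape

section InwardSlide

variable {χ : SkewShape} {T T' : Σ χ : SkewShape, SkewTableau χ}

theorem InwardSlide.placticEquiv (h : InwardSlide T T') : T.2.PlacticEquiv T'.2 := by
  obtain ⟨s, t, hs, hinner, houter, hst, -⟩ := h
  have inner_le : T'.1.inner.cells ⊆ T.1.inner.cells := hinner ▸ Finset.erase_subset _ _
  let ψ : SkewShape := ⟨T.1.outer, T'.1.inner, inner_le.trans T.1.inner_le⟩
  obtain ⟨hsψ, before⟩ := cells_eq_erase_of_inner (χ := T.1) (ψ := ψ) rfl hinner hs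
  have after : T'.1.cells = ψ.cells.erase t := by
    simp only [ψ, SkewShape.cells, houter, Finset.erase_sdiff_comm]
  obtain ⟨-, hequiv⟩ := (T.2.isPunctured hsψ before).reflTransGen_slideMove (s := (_, _)) hst
  rw [← T.2.word_eq_puncturedWord before, ← T'.2.word_eq_puncturedWord after] at hequiv
  exact hequiv.exists_coplacticAut

theorem inner_eq_bot_iff : χ.inner = ⊥ ↔ (0, 0) ∉ χ.inner := by
  refine ⟨fun h => h ▸ YoungDiagram.notMem_bot _, fun h => YoungDiagram.ext ?_⟩
  exact Finset.eq_empty_iff_forall_notMem.2 fun c hc =>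
    h (χ.inner.up_left_mem c.1.zero_le c.2.zero_le hc)

theorem exists_inwardSlide (T : SkewTableau χ) (hχ : χ.inner ≠ ⊥) :
    ∃ T', InwardSlide ⟨χ, T⟩ T' := by
  have nonempty : χ.inner.cells.Nonempty := ⟨_, not_not.1 (mt inner_eq_bot_iff.2 hχ)⟩
  obtain ⟨s, hs, hmax⟩ := χ.inner.cells.exists_maximal nonempty
  have below : (s.1 + 1, s.2) ∉ χ.inner := fun h =>
    absurd (hmax h ⟨s.1.le_succ, le_rfl⟩).1 (Nat.not_succ_le_self _)
  have right : (s.1, s.2 + 1) ∉ χ.inner := fun h =>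
    absurd (hmax h ⟨le_rfl, s.2.le_succ⟩).2 (Nat.not_succ_le_self _)
  obtain ⟨inner, hinner⟩ := exists_cells_eq_erase below right
  have inner_le : inner.cells ⊆ χ.inner.cells := hinner ▸ Finset.erase_subset _ _
  let ψ : SkewShape := ⟨χ.outer, inner, inner_le.trans χ.inner_le⟩
  obtain ⟨hsψ, before⟩ := cells_eq_erase_of_inner (χ := χ) (ψ := ψ) rfl hinner hs
  obtain ⟨⟨t, f⟩, hst, ht⟩ := exists_isNormalFormOf_slideMove χ.outer (s, T.entry)
  obtain ⟨hf, -⟩ := (T.isPunctured hsψ before).reflTransGen_slideMove (s := (_, _)) hst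
  obtain ⟨below, right⟩ := notMem_of_forall_not_slideMove ht
  obtain ⟨outer, houter⟩ := exists_cells_eq_erase below right
  have inner_le' : inner.cells ⊆ outer.cells := houter ▸
    Finset.subset_erase.2 ⟨ψ.inner_le, (Finset.mem_sdiff.1 hf.mem).2⟩
  let χ' : SkewShape := ⟨outer, inner, inner_le'⟩
  have after : χ'.cells = ψ.cells.erase t := by
    simp only [χ', ψ, SkewShape.cells, houter, Finset.erase_sdiff_comm]
  obtain ⟨T', rfl⟩ := hf.exists_entry_eq after
  exact ⟨⟨χ', T'⟩, s, t, hs, hinner, houter, hst, ht⟩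

theorem forall_not_inwardSlide_iff :
    (∀ T', ¬ InwardSlide T T') ↔ T.1.inner = ⊥ := by
  refine ⟨fun h => ?_, fun h T' ⟨s, _, hs, _⟩ => YoungDiagram.notMem_bot s (h ▸ hs)⟩
  by_contra hT
  obtain ⟨T', hT'⟩ := exists_inwardSlide T.2 hT
  exact h T' hT'

theorem reflTransGen_inwardSlide_placticEquiv (h : Relation.ReflTransGen InwardSlide T T') :
    T.2.PlacticEquiv T'.2 := by
  induction h with
  | refl => exact .refl _
  | tail _ h ih => exact ih.trans h.placticEquiv

theorem exists_eq_ofPartition (hT : T.1.inner = ⊥) :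
    ∃ ν, ∃ P : SkewTableau (.ofPartition ν), T = ⟨.ofPartition ν, P⟩ := by
  obtain ⟨⟨outer, inner, _⟩, P⟩ := T
  obtain rfl : inner = ⊥ := hT
  exact ⟨outer, P, rfl⟩

theorem exists_isNormalFormOf_inwardSlide (T : Σ χ : SkewShape, SkewTableau χ) :
    ∃ T', IsNormalFormOf InwardSlide T T' :=
  exists_isNormalFormOf_of_measure (fun T => T.1.inner.card)
    (fun T T' ⟨s, _, hs, hinner, _⟩ => by
      exact (congrArg Finset.card hinner).trans_lt (Finset.card_erase_lt_of_mem hs)) T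

theorem SkewTableau.exists_placticEquiv_ofPartition (T : SkewTableau χ) :
    ∃ ν, ∃ P : SkewTableau (.ofPartition ν), T.PlacticEquiv P := by
  obtain ⟨T', h, hT'⟩ := exists_isNormalFormOf_inwardSlide ⟨χ, T⟩
  obtain ⟨ν, P, rfl⟩ := exists_eq_ofPartition (forall_not_inwardSlide_iff.1 hT')
  exact ⟨ν, P, reflTransGen_inwardSlide_placticEquiv h⟩

theorem isNormalFormOf_inwardSlide_iff {T : SkewTableau χ} {ν : YoungDiagram}
    {P : SkewTableau (.ofPartition ν)} (hTP : T.PlacticEquiv P) :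
    IsNormalFormOf InwardSlide ⟨χ, T⟩ T' ↔ T' = ⟨.ofPartition ν, P⟩ := by
  have unique {T'} (hT' : IsNormalFormOf InwardSlide ⟨χ, T⟩ T') : T' = ⟨.ofPartition ν, P⟩ := by
    obtain ⟨ν', P', rfl⟩ := exists_eq_ofPartition (forall_not_inwardSlide_iff.1 hT'.2)
    have hP' := reflTransGen_inwardSlide_placticEquiv hT'.1
    cases SkewTableau.eq_of_placticEquiv (hP'.symm.trans hTP)
    rfl
  refine ⟨unique, ?_⟩
  rintro rfl
  obtain ⟨T', hT'⟩ := exists_isNormalFormOf_inwardSlide ⟨χ, T⟩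
  exact unique hT' ▸ hT'

end InwardSlide

section Robinson

variable {χ : SkewShape} {n : ℕ} {ν : YoungDiagram} {T L : SkewTableau χ}
  {P : SkewTableau (.ofPartition ν)}

theorem SkewTableau.exists_placticEquiv_of_weight_eq_rowLen (hL : L.IsDominant)
    (hν : L.weight = ν.rowLen) (P : SkewTableau (.ofPartition ν)) :
    ∃ T : SkewTableau χ, WordRaises (T.word χ.semitic) (L.word χ.semitic) ∧ T.PlacticEquiv P := by
  obtain ⟨ν', Q, hLQ⟩ := L.exists_placticEquiv_ofPartition
  obtain rfl := rowLen_injective (hν.symm.trans (hLQ.weight_eq_rowLen .refl hL))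
  obtain ⟨Q', hPQ', hQ'⟩ := P.exists_wordRaises_and_isDominant
  obtain ⟨φ, hφ, hQL⟩ := hLQ.symm
  have hQ : Q.IsDominant := fun i =>
    (wordDominantFor_apply_iff_of_mem_coplacticAut hφ i).1 (hQL ▸ hL i)
  obtain rfl := eq_of_isDominant hQ hQ'
  rw [← wordRaises_apply_iff_of_mem_coplacticAut hφ, hQL] at hPQ'
  obtain ⟨T, hT⟩ := exists_word_eq_of_wordRaises_word hPQ'
  exact ⟨T, hT ▸ hPQ', PlacticEquiv.symm ⟨φ, hφ, hT.symm⟩⟩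

/-- `(L, P)` is the image of `T` under the Robinson correspondence: `L` is a normal form of `T` for
the raising operations, and `P` is a rectification of `T`. The latter is expressed by plactic
equivalence, which determines `P` and is easier to transport along raising operations than jeu de
taquin. -/
structure IsRobinsonPair (T L : SkewTableau χ) (P : SkewTableau (.ofPartition ν)) : Prop where
  wordRaises : WordRaises (T.word χ.semitic) (L.word χ.semitic)
  isDominant : L.IsDominant
  placticEquiv : T.PlacticEquiv P

theorem SkewTableau.PlacticEquiv.forall_entry_lt {χ' : SkewShape} {T : SkewTableau χ}
    {U : SkewTableau χ'} (h : T.PlacticEquiv U) (hT : ∀ c ∈ χ.cells, T.entry c < n) :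
    ∀ c ∈ χ'.cells, U.entry c < n := by
  intro c hc
  have hmem : U.entry c ∈ T.word χ.semitic :=
    h.perm.mem_iff.2 (SkewTableau.mem_word_iff.2 ⟨c, hc, rfl⟩)
  obtain ⟨d, hd, hdc⟩ := SkewTableau.mem_word_iff.1 hmem
  exact hdc ▸ hT d hd

theorem existsUnique_isRobinsonPair (T : Tab χ n) :
    ∃! R : Σ ν : YoungDiagram, LR χ ν × Tab (.ofPartition ν) n,
      IsRobinsonPair T.1 R.2.1.1 R.2.2.1 := by
  obtain ⟨L, hTL, hL⟩ := T.1.exists_wordRaises_and_isDominant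
  obtain ⟨ν, P, hTP⟩ := T.1.exists_placticEquiv_ofPartition
  refine ⟨⟨ν, ⟨L, hL, congrFun (hTP.weight_eq_rowLen hTL hL)⟩, P, hTP.forall_entry_lt T.2⟩,
    ⟨hTL, hL, hTP⟩, ?_⟩
  rintro ⟨ν', L', P'⟩ ⟨hTL', hL', hTP'⟩
  cases SkewTableau.eq_of_placticEquiv (hTP'.symm.trans hTP)
  obtain rfl : L = L'.1 := hTP.dominant_unique hTL hL hTL' hL'
  rfl

theorem existsUnique_isRobinsonPair_of_weight (L : LR χ ν) (P : Tab (.ofPartition ν) n) :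
    ∃! T : Tab χ n, IsRobinsonPair T.1 L.1 P.1 := by
  obtain ⟨T, hTL, hTP⟩ :=
    SkewTableau.exists_placticEquiv_of_weight_eq_rowLen L.2.1 (funext L.2.2) P.1
  refine ⟨⟨T, hTP.symm.forall_entry_lt P.2⟩, ⟨hTL, L.2.1, hTP⟩, fun T' h => Subtype.ext ?_⟩
  exact SkewTableau.eq_of_placticEquiv_of_wordRaises h.placticEquiv hTP h.wordRaises hTL L.2.1

theorem IsRobinsonPair.isNormalFormOf_raisingStep_iff (h : IsRobinsonPair T L P)
    {r : ReadingOrder χ} {L' : SkewTableau χ} :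
    IsNormalFormOf (RaisingStep r) T L' ↔ L' = L := by
  rw [SkewTableau.isNormalFormOf_raisingStep_iff]
  refine ⟨fun h' => h.placticEquiv.dominant_unique h'.1 h'.2 h.wordRaises h.isDominant, ?_⟩
  rintro rfl
  exact ⟨h.wordRaises, h.isDominant⟩

end Robinson

theorem mainTheorem4 (χ : SkewShape) (n : ℕ) :
    ∃ Rob : Tab χ n → Σ ν : YoungDiagram, LR χ ν × Tab (SkewShape.ofPartition ν) n,
      Function.Bijective Rob ∧
      ∀ T : Tab χ n,
        (∀ i : ℕ, (Rob T).2.2.1.weight i = T.1.weight i) ∧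
        (∀ (r : ReadingOrder χ) (L : SkewTableau χ),
          IsNormalFormOf (RaisingStep r) T.1 L ↔ L = (Rob T).2.1.1) ∧
        (∀ P : Σ χ' : SkewShape, SkewTableau χ',
          IsNormalFormOf InwardSlide ⟨χ, T.1⟩ P ↔
            P = ⟨SkewShape.ofPartition (Rob T).1, (Rob T).2.2.1⟩) := by
  choose Rob hRob hRob_unique using existsUnique_isRobinsonPair (χ := χ) (n := n)
  refine ⟨Rob, Function.bijective_iff_existsUnique Rob |>.2 fun R => ?_, fun T => ⟨?_, ?_, ?_⟩⟩
  · refine (existsUnique_congr fun T => ?_).1 (existsUnique_isRobinsonPair_of_weight R.2.1 R.2.2)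
    exact ⟨fun h => (hRob_unique T R h).symm, fun h => h ▸ hRob T⟩
  · exact congrFun
      (SkewTableau.weight_eq_weight_of_perm (hRob T).placticEquiv.perm.symm)
  · exact fun r L => (hRob T).isNormalFormOf_raisingStep_iff
  · exact fun P => isNormalFormOf_inwardSlide_iff (hRob T).placticEquiv
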